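/- **Setting.** Fix a signature $\Sigma$ assigning to run-time operations types $\mathsf{op}:S^0\to T^0$ and to compile-time operations types $\mathsf{op}:S^{-1}\to T^{-1}$. *Types.* Let $\xi$ and $\Delta$ range over finite sets of run-time, respectively compile-time, operations. Level $0$ types are $\mathbb N$, functions $S\xrightarrow{\xi}T$ and continuations $S\stackrel{\xi}{\rightsquigarrow}T$. Level $-1$ types are $\mathbb N$, $S\xrightarrow{\Delta}T$, $S\stackrel{\Delta}{\rightsquigarrow}T$ and $\mathsf{Code}(T^0!\xi)^\gamma$, where $\gamma$ is a *classifier* (the name of a scope); $\gamma_\bot$ is the least classifier. A classifier is *mentioned* by a level $-1$ type if it annotates a $\mathsf{Code}$ type in it, or is mentioned (recursively) by the argument or result type in $\Sigma$ of an operation in one of its effect sets. *Source language.* The source language is the two-stage, fine-grained call-by-value calculus $\lambda_{\langle\langle\mathsf{op}\rangle\rangle}^{\gamma}$ with values $x\mid m\mid\lambda x.e$, expressions $v_1v_2\mid\mathbf{return}\,v\mid\mathbf{do}\,x\leftarrow e_1\,\mathbf{in}\,e_2\mid\mathsf{op}(v)\mid\mathbf{handle}\,e\,\mathbf{with}\,h\mid\mathbf{continue}\,v_1\,v_2\mid\langle\langle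 e\rangle\rangle\mid\$e$, and deep handlers $\mathbf{return}(x)\mapsto e\mid h;\mathsf{op}(x,k)\mapsto e$. It is typed in contexts of entries $(x:T^0)^\gamma$, $x:T^{-1}$, $\gamma$, $\gamma\sqsubseteq\gamma'$; contexts contain $\gamma_\bot$, and $x:T^{-1}$ may be added to $\Gamma$ only if all classifiers mentioned by $T^{-1}$ are in $\Gamma$. The judgements are $\Gamma\vdash^\gamma_{c|q}e:T^0!\Delta;\xi$ at level $0$ (compile and quote modes) and $\Gamma\vdash_s e:T^{-1}!\Delta$ at level $-1$ (splice mode), with analogous ones for values and handlers. The effect rules are the usual ones, and the characteristic rules are these: - A level $0$ variable $(x:T)^\gamma$ is typed at $\gamma$. - A level $0$ binder in scope $\gamma\in\Gamma$ types its body at some $\gamma'\notin\Gamma$ in $\Gamma,\gamma',\gamma\sqsubseteq\gamma'$, with the bound variables classified by $\gamma'$. - $\$e$ has type $T!\Delta;\xi$ at $\gamma$ if $\Gamma\vdash_s e:\mathsf{Code}(T!\xi)^\gamma!\Delta$, and $\langle\langle e\rangle\rangle$ has type $\mathsf{Code}(T!\xi)^\gamma!\Delta$ if $\Gamma\vdash_q^\gamma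 e:T!\Delta;\xi$. - Level $0$ terms at $\gamma'$, and level $-1$ expressions of type $\mathsf{Code}(T!\xi)^{\gamma'}$, may be used at $\gamma$ if $\Gamma\vDash\gamma'\sqsubseteq\gamma$. - At level $-1$, the results of operations, and the arguments and results of continuations and handlers, have $\mathsf{Code}$ types. A handler, its clauses and the results of the operations it handles share one classifier $\gamma$. *Elaboration.* The elaboration $[\![e]\!]_c$ is a term of a core calculus with effect handlers, AST constructors and a primitive $\mathsf{mkvar}$ that generates a fresh formal parameter $\alpha_R^\gamma$. Level $0$ syntax becomes a computation that builds its AST, calling $\mathsf{mkvar}$ at each binder; level $-1$ syntax becomes itself; quotes and splices disappear. A core configuration $\langle t;E;U\rangle$ consists of a term, an evaluation context (a stack of frames) and the finite set of names generated so far. Fresh names are given by a fixed function $\mathsf{next}$ with $\mathsf{next}(U)\notin U$. $\mathsf{FVs}(n)$ is the set of those $\mathsf{Var}(\alpha_R^\gamma)$ in the normal form $n$ that are not bound by an enclosing AST binder for $\alpha_R^\gamma$. **Theorem (Correctness of Refined Environment Classifiers).** Suppose $\gamma_\bot\vdash_c^{\gamma_\bot}e:T^0!\emptyset;\emptyset$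 and $[\![e]\!]_c=t$. Then: 1. Every configuration reachable from $\langle t;[-];\emptyset\rangle$ either is of the form $\langle\mathbf{return}\,n;[-];U\rangle$ with $\mathsf{FVs}(n)=\emptyset$, or can take a reduction step. In particular, whenever execution terminates, it returns a normal form without free variables. 2. Suppose the compile-time part of $\Sigma$ is not recursive, i.e. the relation "$\mathsf{op}'$ occurs in an effect set of the argument or result type of $\mathsf{op}$" on compile-time operations is well-founded. Then for some $n$ and $U$, $\langle t;[-];\emptyset\rangle\to^*\langle\mathbf{return}\,n;[-];U\rangle$ and $\mathsf{FVs}(n)=\emptyset$. -/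

import Mathlib

/-!
The staged calculus with quotes, splices, effect handlers and refined environment classifiers
(types, terms, typing), its core language of AST constructors and effect handlers (terms, reduction
on configurations), and the elaboration of the former into the latter.

Variables of both languages are de Bruijn indices, so terms are taken up to renaming of bound
variables.
-/

namespace RefinedClassifiers

/-- Names of operations. -/
abbrev OpName := ℕ

/-- Environment classifiers. -/
abbrev Cls := ℕ

/-- The least classifier `γ⊥`. -/
def clsBot : Cls := 0

/-! ### Types of the source language -/

/-- Level `0` value types: `ℕ⁰`, `(S -ξ→ T)⁰`, `(S -ξ↝ T)⁰`. -/
inductive Ty0 : Type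
  | nat : Ty0
  | fn : Ty0 → Finset OpName → Ty0 → Ty0
  | cont : Ty0 → Finset OpName → Ty0 → Ty0

/-- Level `-1` value types: `ℕ⁻¹`, `(S -Δ→ T)⁻¹`, `(S -Δ↝ T)⁻¹`, `(Code(T⁰ ! ξ)^γ)⁻¹`. -/
inductive TyM : Type
  | nat : TyM
  | fn : TyM → Finset OpName → TyM → TyM
  | cont : TyM → Finset OpName → TyM → TyM
  | code : Ty0 → Finset OpName → Cls → TyM

/-- The signature `Σ`: argument and result types of the run-time (level `0`) operations and of the
compile-time (level `-1`) operations. -/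
structure Sig where
  run : OpName → Option (Ty0 × Ty0)
  comp : OpName → Option (TyM × TyM)

/-- The classifiers annotating the `Code` types in a type. -/
def TyM.cls : TyM → Finset Cls
  | .nat => ∅
  | .fn S _ T => S.cls ∪ T.cls
  | .cont S _ T => S.cls ∪ T.cls
  | .code _ _ γ => {γ}

/-- The compile-time operations in the effect sets of a type. -/
def TyM.ops : TyM → Finset OpName
  | .nat => ∅
  | .fn S Δ T => S.ops ∪ Δ ∪ T.ops
  | .cont S Δ T => S.ops ∪ Δ ∪ T.ops
  | .code _ _ _ => ∅

/-- `γ` is one of the classifiers of the type: it annotates a `Code` type in it, or it is one of the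
classifiers of the argument or result type of an operation in one of its effect sets. -/
inductive Mentions (Sg : Sig) : TyM → Cls → Prop
  | here {T : TyM} {γ : Cls} : γ ∈ T.cls → Mentions Sg T γ
  | arg {T A B : TyM} {o : OpName} {γ : Cls} :
      o ∈ T.ops → Sg.comp o = some (A, B) → Mentions Sg A γ → Mentions Sg T γ
  | res {T A B : TyM} {o : OpName} {γ : Cls} :
      o ∈ T.ops → Sg.comp o = some (A, B) → Mentions Sg B γ → Mentions Sg T γ

/-- `o'` occurs in an effect set of the type that the signature gives to the compile-time operation
`o`. -/
def Sig.Dep (Sg : Sig) (o' o : OpName) : Prop :=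
  ∃ A B : TyM, Sg.comp o = some (A, B) ∧ o' ∈ A.ops ∪ B.ops

/-- The signature of compile-time operations is not recursive. -/
def Sig.NonRecursive (Sg : Sig) : Prop := WellFounded Sg.Dep

/-! ### Terms of the source language

Each mode determines a level, so the terms are presented per level: level `0` (modes `c` and `q`) and
level `-1` (mode `s`). Level `0` binders carry their extended type, that is, a level `0` type with a
classifier; this is what elaboration needs. Level `-1` binders need no annotation. -/

/-- Annotation `T⁰(γ)` of a level `0` formal parameter. -/
structure Ann where
  ty : Ty0
  cls : Cls

mutual

/-- Level `0` values. -/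
inductive Val0 : Type
  | var : ℕ → Val0
  | nat : ℕ → Val0
  | lam : Ann → Exp0 → Val0

/-- Level `0` expressions. -/
inductive Exp0 : Type
  | app : Val0 → Val0 → Exp0
  | ret : Val0 → Exp0
  | bind : Ann → Exp0 → Exp0 → Exp0
  | op : OpName → Val0 → Exp0
  | handle : Exp0 → Hdl0 → Exp0
  | continue : Val0 → Val0 → Exp0
  | splice : ExpM → Exp0

/-- Level `0` handlers: `return(x) ↦ e` and `h; op(x, k) ↦ e`. In the body of the latter `k` is
variable `0` and `x` is variable `1`. -/
inductive Hdl0 : Type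
  | ret : Ann → Exp0 → Hdl0
  | op : Hdl0 → OpName → Ann → Ann → Exp0 → Hdl0

/-- Level `-1` values. -/
inductive ValM : Type
  | var : ℕ → ValM
  | nat : ℕ → ValM
  | lam : ExpM → ValM

/-- Level `-1` expressions. -/
inductive ExpM : Type
  | app : ValM → ValM → ExpM
  | ret : ValM → ExpM
  | bind : ExpM → ExpM → ExpM
  | op : OpName → ValM → ExpM
  | handle : ExpM → HdlM → ExpM
  | continue : ValM → ValM → ExpM
  | quote : Exp0 → ExpM

/-- Level `-1` handlers: `return(x) ↦ e` and `h; op(x, k) ↦ e`. -/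
inductive HdlM : Type
  | ret : ExpM → HdlM
  | op : HdlM → OpName → ExpM → HdlM

end

/-- The operations that a level `0` handler has clauses for. -/
def Hdl0.dom : Hdl0 → Finset OpName
  | .ret _ _ => ∅
  | .op h o _ _ _ => insert o h.dom

/-- The operations that a level `-1` handler has clauses for. -/
def HdlM.dom : HdlM → Finset OpName
  | .ret _ => ∅
  | .op h o _ => insert o h.dom

/-! ### Typing contexts -/

/-- A variable of a context: `(x : T⁰)^γ` or `x : T⁻¹`. -/
inductive Entry : Type
  | lv0 : Ty0 → Cls → Entry
  | lvM : TyM → Entry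

/-- Typing contexts: variables (the most recent one first), classifiers, and assumed inequalities
`γ ⊑ γ'` between classifiers. -/
structure Ctx where
  vars : List Entry
  cls : Finset Cls
  ord : Finset (Cls × Cls)

/-- The context `γ⊥`. -/
def Ctx.bot : Ctx := ⟨[], {clsBot}, ∅⟩

/-- `Γ, (x : T⁰)^γ` -/
def Ctx.var0 (Γ : Ctx) (T : Ty0) (γ : Cls) : Ctx := { Γ with vars := .lv0 T γ :: Γ.vars }

/-- `Γ, x : T⁻¹` -/
def Ctx.varM (Γ : Ctx) (T : TyM) : Ctx := { Γ with vars := .lvM T :: Γ.vars }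

/-- `Γ, γ', γ ⊑ γ'` -/
def Ctx.scope (Γ : Ctx) (γ γ' : Cls) : Ctx :=
  { Γ with cls := insert γ' Γ.cls, ord := insert (γ, γ') Γ.ord }

/-- `Γ ⊨ γ ⊑ γ'`: the inequality follows from those in `Γ`, `γ⊥` being least. -/
inductive Ctx.Le (Γ : Ctx) : Cls → Cls → Prop
  | refl (γ : Cls) : Γ.Le γ γ
  | bot {γ : Cls} : γ ∈ Γ.cls → Γ.Le clsBot γ
  | assum {γ γ' : Cls} : (γ, γ') ∈ Γ.ord → Γ.Le γ γ'
  | trans {γ γ' γ'' : Cls} : Γ.Le γ γ' → Γ.Le γ' γ'' → Γ.Le γ γ''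

/-- `Γ ⊢ T⁻¹`: all classifiers of the type are in `Γ`. -/
def Ctx.Wf (Sg : Sig) (Γ : Ctx) (T : TyM) : Prop := ∀ γ, Mentions Sg T γ → γ ∈ Γ.cls

/-! ### Typing

Only well-formed contexts are considered: a context is extended by `x : T⁻¹` only if `Γ ⊢ T⁻¹`
(level `0` types contain no classifiers). -/

/-- The two modes at level `0`: compile and quote. -/
inductive Mode : Type
  | c
  | q

mutual

/-- `Γ ⊢_{c|q}^γ v : T⁰ ! Δ` -/
inductive TyVal0 (Sg : Sig) : Mode → Ctx → Cls → Val0 → Ty0 → Finset OpName → Prop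
  | nat {M : Mode} {Γ : Ctx} {γ : Cls} {Δ : Finset OpName} (m : ℕ) :
      TyVal0 Sg M Γ γ (.nat m) .nat Δ
  | var {M : Mode} {Γ : Ctx} {γ : Cls} {Δ : Finset OpName} {i : ℕ} {T : Ty0} :
      Γ.vars[i]? = some (.lv0 T γ) →
      TyVal0 Sg M Γ γ (.var i) T Δ
  | lam {M : Mode} {Γ : Ctx} {γ γ' : Cls} {Δ ξ : Finset OpName} {S T : Ty0} {e : Exp0} :
      γ ∈ Γ.cls → γ' ∉ Γ.cls →
      TyExp0 Sg M ((Γ.scope γ γ').var0 S γ') γ' e T Δ ξ →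
      TyVal0 Sg M Γ γ (.lam ⟨S, γ'⟩ e) (.fn S ξ T) Δ
  | sub {M : Mode} {Γ : Ctx} {γ γ' : Cls} {Δ : Finset OpName} {v : Val0} {T : Ty0} :
      Γ.Le γ' γ →
      TyVal0 Sg M Γ γ' v T Δ →
      TyVal0 Sg M Γ γ v T Δ

/-- `Γ ⊢_{c|q}^γ e : T⁰ ! Δ; ξ` -/
inductive TyExp0 (Sg : Sig) :
    Mode → Ctx → Cls → Exp0 → Ty0 → Finset OpName → Finset OpName → Prop
  | app {M : Mode} {Γ : Ctx} {γ : Cls} {Δ ξ : Finset OpName} {v₁ v₂ : Val0} {S T : Ty0} :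
      TyVal0 Sg M Γ γ v₁ (.fn S ξ T) Δ →
      TyVal0 Sg M Γ γ v₂ S Δ →
      TyExp0 Sg M Γ γ (.app v₁ v₂) T Δ ξ
  | continue {M : Mode} {Γ : Ctx} {γ : Cls} {Δ ξ : Finset OpName} {v₁ v₂ : Val0} {S T : Ty0} :
      TyVal0 Sg M Γ γ v₁ (.cont S ξ T) Δ →
      TyVal0 Sg M Γ γ v₂ S Δ →
      TyExp0 Sg M Γ γ (.continue v₁ v₂) T Δ ξ
  | ret {M : Mode} {Γ : Ctx} {γ : Cls} {Δ ξ : Finset OpName} {v : Val0} {T : Ty0} :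
      TyVal0 Sg M Γ γ v T Δ →
      TyExp0 Sg M Γ γ (.ret v) T Δ ξ
  | bind {M : Mode} {Γ : Ctx} {γ γ' : Cls} {Δ ξ : Finset OpName} {e₁ e₂ : Exp0} {S T : Ty0} :
      γ ∈ Γ.cls → γ' ∉ Γ.cls →
      TyExp0 Sg M Γ γ e₁ S Δ ξ →
      TyExp0 Sg M ((Γ.scope γ γ').var0 S γ') γ' e₂ T Δ ξ →
      TyExp0 Sg M Γ γ (.bind ⟨S, γ'⟩ e₁ e₂) T Δ ξ
  | op {M : Mode} {Γ : Ctx} {γ : Cls} {Δ ξ : Finset OpName} {o : OpName} {v : Val0} {S T : Ty0} :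
      TyVal0 Sg M Γ γ v S Δ →
      Sg.run o = some (S, T) → o ∈ ξ →
      TyExp0 Sg M Γ γ (.op o v) T Δ ξ
  | handle {M : Mode} {Γ : Ctx} {γ : Cls} {Δ ξ₁ ξ₂ : Finset OpName} {e : Exp0} {h : Hdl0}
      {S T : Ty0} :
      TyExp0 Sg M Γ γ e S Δ ξ₁ →
      TyHdl0 Sg M Γ γ h S ξ₁ T ξ₂ Δ →
      (∀ o ∈ ξ₁ \ ξ₂, o ∈ h.dom) →
      TyExp0 Sg M Γ γ (.handle e h) T Δ ξ₂
  | splice {M : Mode} {Γ : Ctx} {γ : Cls} {Δ ξ : Finset OpName} {e : ExpM} {T : Ty0} :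
      TyExpM Sg Γ e (.code T ξ γ) Δ →
      TyExp0 Sg M Γ γ (.splice e) T Δ ξ
  | sub {M : Mode} {Γ : Ctx} {γ γ' : Cls} {Δ ξ : Finset OpName} {e : Exp0} {T : Ty0} :
      Γ.Le γ' γ →
      TyExp0 Sg M Γ γ' e T Δ ξ →
      TyExp0 Sg M Γ γ e T Δ ξ

/-- `Γ ⊢_{c|q}^γ h : (S⁰ ! ξ₁ ⟹ T⁰ ! ξ₂)⁰ ! Δ` -/
inductive TyHdl0 (Sg : Sig) :
    Mode → Ctx → Cls → Hdl0 → Ty0 → Finset OpName → Ty0 → Finset OpName → Finset OpName → Prop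
  | ret {M : Mode} {Γ : Ctx} {γ γ' : Cls} {Δ ξ₁ ξ₂ : Finset OpName} {e : Exp0} {S T : Ty0} :
      γ ∈ Γ.cls → γ' ∉ Γ.cls →
      TyExp0 Sg M ((Γ.scope γ γ').var0 S γ') γ' e T Δ ξ₂ →
      TyHdl0 Sg M Γ γ (.ret ⟨S, γ'⟩ e) S ξ₁ T ξ₂ Δ
  | op {M : Mode} {Γ : Ctx} {γ γ' : Cls} {Δ ξ₁ ξ₂ : Finset OpName} {o : OpName} {h : Hdl0}
      {e : Exp0} {S T A B : Ty0} :
      γ ∈ Γ.cls → γ' ∉ Γ.cls →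
      Sg.run o = some (A, B) →
      TyHdl0 Sg M Γ γ h S ξ₁ T ξ₂ Δ →
      TyExp0 Sg M (((Γ.scope γ γ').var0 A γ').var0 (.cont B ξ₂ T) γ') γ' e T Δ ξ₂ →
      ξ₁ ⊆ ξ₂ ∪ {o} → o ∉ h.dom →
      TyHdl0 Sg M Γ γ (.op h o ⟨A, γ'⟩ ⟨.cont B ξ₂ T, γ'⟩ e) S ξ₁ T ξ₂ Δ
  | sub {M : Mode} {Γ : Ctx} {γ γ' : Cls} {Δ ξ₁ ξ₂ : Finset OpName} {h : Hdl0} {S T : Ty0} :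
      Γ.Le γ' γ →
      TyHdl0 Sg M Γ γ' h S ξ₁ T ξ₂ Δ →
      TyHdl0 Sg M Γ γ h S ξ₁ T ξ₂ Δ

/-- `Γ ⊢_s v : T⁻¹` -/
inductive TyValM (Sg : Sig) : Ctx → ValM → TyM → Prop
  | nat {Γ : Ctx} (m : ℕ) : TyValM Sg Γ (.nat m) .nat
  | var {Γ : Ctx} {i : ℕ} {T : TyM} :
      Γ.vars[i]? = some (.lvM T) →
      TyValM Sg Γ (.var i) T
  | lam {Γ : Ctx} {Δ : Finset OpName} {S T : TyM} {e : ExpM} :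
      Γ.Wf Sg S →
      TyExpM Sg (Γ.varM S) e T Δ →
      TyValM Sg Γ (.lam e) (.fn S Δ T)

/-- `Γ ⊢_s e : T⁻¹ ! Δ` -/
inductive TyExpM (Sg : Sig) : Ctx → ExpM → TyM → Finset OpName → Prop
  | app {Γ : Ctx} {Δ : Finset OpName} {v₁ v₂ : ValM} {S T : TyM} :
      TyValM Sg Γ v₁ (.fn S Δ T) →
      TyValM Sg Γ v₂ S →
      TyExpM Sg Γ (.app v₁ v₂) T Δ
  | continue {Γ : Ctx} {Δ ξ₁ ξ₂ : Finset OpName} {γ γ' : Cls} {v₁ v₂ : ValM} {S T : Ty0} :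
      TyValM Sg Γ v₁ (.cont (.code S ξ₁ γ) Δ (.code T ξ₂ γ')) →
      TyValM Sg Γ v₂ (.code S ξ₁ γ) →
      TyExpM Sg Γ (.continue v₁ v₂) (.code T ξ₂ γ') Δ
  | ret {Γ : Ctx} {Δ : Finset OpName} {v : ValM} {T : TyM} :
      TyValM Sg Γ v T →
      TyExpM Sg Γ (.ret v) T Δ
  | bind {Γ : Ctx} {Δ : Finset OpName} {e₁ e₂ : ExpM} {S T : TyM} :
      Γ.Wf Sg S →
      TyExpM Sg Γ e₁ S Δ →
      TyExpM Sg (Γ.varM S) e₂ T Δ →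
      TyExpM Sg Γ (.bind e₁ e₂) T Δ
  | op {Γ : Ctx} {Δ ξ : Finset OpName} {γ : Cls} {o : OpName} {v : ValM} {S : TyM} {T : Ty0} :
      TyValM Sg Γ v S →
      o ∈ Δ → Sg.comp o = some (S, .code T ξ γ) →
      TyExpM Sg Γ (.op o v) (.code T ξ γ) Δ
  | handle {Γ : Ctx} {Δ₁ Δ₂ ξ₁ ξ₂ : Finset OpName} {γ : Cls} {e : ExpM} {h : HdlM} {S T : Ty0} :
      TyExpM Sg Γ e (.code S ξ₁ γ) Δ₁ →
      TyHdlM Sg Γ h (.code S ξ₁ γ) Δ₁ (.code T ξ₂ γ) Δ₂ →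
      (∀ o ∈ Δ₁ \ Δ₂, o ∈ h.dom) →
      TyExpM Sg Γ (.handle e h) (.code T ξ₂ γ) Δ₂
  | quote {Γ : Ctx} {Δ ξ : Finset OpName} {γ : Cls} {e : Exp0} {T : Ty0} :
      TyExp0 Sg .q Γ γ e T Δ ξ →
      TyExpM Sg Γ (.quote e) (.code T ξ γ) Δ
  | sub {Γ : Ctx} {Δ ξ : Finset OpName} {γ γ' : Cls} {e : ExpM} {T : Ty0} :
      Γ.Le γ' γ →
      TyExpM Sg Γ e (.code T ξ γ') Δ →
      TyExpM Sg Γ e (.code T ξ γ) Δ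

/-- `Γ ⊢_s h : (S⁻¹ ! Δ₁ ⟹ T⁻¹ ! Δ₂)⁻¹` -/
inductive TyHdlM (Sg : Sig) :
    Ctx → HdlM → TyM → Finset OpName → TyM → Finset OpName → Prop
  | ret {Γ : Ctx} {Δ₁ Δ₂ ξ₁ ξ₂ : Finset OpName} {γ : Cls} {e : ExpM} {S T : Ty0} :
      Γ.Wf Sg (.code S ξ₁ γ) →
      TyExpM Sg (Γ.varM (.code S ξ₁ γ)) e (.code T ξ₂ γ) Δ₂ →
      TyHdlM Sg Γ (.ret e) (.code S ξ₁ γ) Δ₁ (.code T ξ₂ γ) Δ₂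
  | op {Γ : Ctx} {Δ₁ Δ₂ ξ ξ₁ ξ₂ : Finset OpName} {γ : Cls} {o : OpName} {h : HdlM} {e : ExpM}
      {S T B : Ty0} {A : TyM} :
      Sg.comp o = some (A, .code B ξ γ) →
      TyHdlM Sg Γ h (.code S ξ₁ γ) Δ₁ (.code T ξ₂ γ) Δ₂ →
      Γ.Wf Sg A → Γ.Wf Sg (.cont (.code B ξ γ) Δ₂ (.code T ξ₂ γ)) →
      TyExpM Sg ((Γ.varM A).varM (.cont (.code B ξ γ) Δ₂ (.code T ξ₂ γ))) e (.code T ξ₂ γ) Δ₂ →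
      Δ₁ ⊆ Δ₂ ∪ {o} → o ∉ h.dom →
      TyHdlM Sg Γ (.op h o e) (.code S ξ₁ γ) Δ₁ (.code T ξ₂ γ) Δ₂

end

/-! ### The core language -/

/-- Run-time pre-types (of values). -/
inductive PreTy : Type
  | nat : PreTy
  | fn : PreTy → Finset OpName → PreTy → PreTy
  | cont : PreTy → Finset OpName → PreTy → PreTy

/-- A formal parameter `α_R^γ`: a name with a run-time pre-type and a classifier. -/
structure Param where
  name : ℕ
  ty : PreTy
  cls : Cls

mutual

/-- Normal forms: variables, numbers, functions `λx. t`, continuations `κx. t`, formal parameters,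
and the AST constructors. -/
inductive Nf : Type
  | var : ℕ → Nf
  | nat : ℕ → Nf
  | lam : Tm → Nf
  | kappa : Tm → Nf
  | param : Param → Nf
  | astNat : ℕ → Nf
  | astVar : Nf → Nf
  | astLam : Nf → Nf → Nf
  | astApp : Nf → Nf → Nf
  | astContinue : Nf → Nf → Nf
  | astRet : Nf → Nf
  /-- `Do(n₁, n₂, n₃)` is the AST of `do n₂ ← n₁ in n₃`. -/
  | astDo : Nf → Nf → Nf → Nf
  | astOp : OpName → Nf → Nf
  | astHandle : Nf → Nf → Nf
  | astHret : Nf → Nf → Nf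
  /-- `H_op(n₁, n₂, n₃, n₄)` is the AST of the handler `n₁; op(n₂, n₃) ↦ n₄`. -/
  | astHop : OpName → Nf → Nf → Nf → Nf → Nf

/-- Terms. -/
inductive Tm : Type
  | app : Nf → Nf → Tm
  | ret : Nf → Tm
  | bind : Tm → Tm → Tm
  | op : OpName → Nf → Tm
  | handle : Tm → Hd → Tm
  | continue : Nf → Nf → Tm
  | mkvar : PreTy → Cls → Tm

/-- Handlers: `return(x) ↦ t` and `h; op(x, k) ↦ t`. In the body of the latter `k` is variable `0`
and `x` is variable `1`. -/
inductive Hd : Type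
  | ret : Tm → Hd
  | op : Hd → OpName → Tm → Hd

end

/-- A renaming under a binder. -/
def upRen (r : ℕ → ℕ) : ℕ → ℕ
  | 0 => 0
  | i + 1 => r i + 1

mutual

/-- Renaming of variables. -/
def Nf.rename (r : ℕ → ℕ) : Nf → Nf
  | .var i => .var (r i)
  | .nat m => .nat m
  | .lam t => .lam (t.rename (upRen r))
  | .kappa t => .kappa (t.rename (upRen r))
  | .param a => .param a
  | .astNat m => .astNat m
  | .astVar n => .astVar (n.rename r)
  | .astLam n₁ n₂ => .astLam (n₁.rename r) (n₂.rename r)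
  | .astApp n₁ n₂ => .astApp (n₁.rename r) (n₂.rename r)
  | .astContinue n₁ n₂ => .astContinue (n₁.rename r) (n₂.rename r)
  | .astRet n => .astRet (n.rename r)
  | .astDo n₁ n₂ n₃ => .astDo (n₁.rename r) (n₂.rename r) (n₃.rename r)
  | .astOp o n => .astOp o (n.rename r)
  | .astHandle n₁ n₂ => .astHandle (n₁.rename r) (n₂.rename r)
  | .astHret n₁ n₂ => .astHret (n₁.rename r) (n₂.rename r)
  | .astHop o n₁ n₂ n₃ n₄ =>
      .astHop o (n₁.rename r) (n₂.rename r) (n₃.rename r) (n₄.rename r)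

/-- Renaming of variables. -/
def Tm.rename (r : ℕ → ℕ) : Tm → Tm
  | .app n₁ n₂ => .app (n₁.rename r) (n₂.rename r)
  | .ret n => .ret (n.rename r)
  | .bind t₁ t₂ => .bind (t₁.rename r) (t₂.rename (upRen r))
  | .op o n => .op o (n.rename r)
  | .handle t h => .handle (t.rename r) (h.rename r)
  | .continue n₁ n₂ => .continue (n₁.rename r) (n₂.rename r)
  | .mkvar R γ => .mkvar R γ

/-- Renaming of variables. -/
def Hd.rename (r : ℕ → ℕ) : Hd → Hd
  | .ret t => .ret (t.rename (upRen r))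
  | .op h o t => .op (h.rename r) o (t.rename (upRen (upRen r)))

end

/-- Extension of a substitution: variable `0` is mapped to `n`. -/
def scons (n : Nf) (s : ℕ → Nf) : ℕ → Nf
  | 0 => n
  | i + 1 => s i

/-- A substitution under a binder. -/
def upSubst (s : ℕ → Nf) : ℕ → Nf := scons (.var 0) fun i => (s i).rename Nat.succ

mutual

/-- Simultaneous capture-avoiding substitution. -/
def Nf.subst (s : ℕ → Nf) : Nf → Nf
  | .var i => s i
  | .nat m => .nat m
  | .lam t => .lam (t.subst (upSubst s))
  | .kappa t => .kappa (t.subst (upSubst s))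
  | .param a => .param a
  | .astNat m => .astNat m
  | .astVar n => .astVar (n.subst s)
  | .astLam n₁ n₂ => .astLam (n₁.subst s) (n₂.subst s)
  | .astApp n₁ n₂ => .astApp (n₁.subst s) (n₂.subst s)
  | .astContinue n₁ n₂ => .astContinue (n₁.subst s) (n₂.subst s)
  | .astRet n => .astRet (n.subst s)
  | .astDo n₁ n₂ n₃ => .astDo (n₁.subst s) (n₂.subst s) (n₃.subst s)
  | .astOp o n => .astOp o (n.subst s)
  | .astHandle n₁ n₂ => .astHandle (n₁.subst s) (n₂.subst s)
  | .astHret n₁ n₂ => .astHret (n₁.subst s) (n₂.subst s)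
  | .astHop o n₁ n₂ n₃ n₄ => .astHop o (n₁.subst s) (n₂.subst s) (n₃.subst s) (n₄.subst s)

/-- Simultaneous capture-avoiding substitution. -/
def Tm.subst (s : ℕ → Nf) : Tm → Tm
  | .app n₁ n₂ => .app (n₁.subst s) (n₂.subst s)
  | .ret n => .ret (n.subst s)
  | .bind t₁ t₂ => .bind (t₁.subst s) (t₂.subst (upSubst s))
  | .op o n => .op o (n.subst s)
  | .handle t h => .handle (t.subst s) (h.subst s)
  | .continue n₁ n₂ => .continue (n₁.subst s) (n₂.subst s)
  | .mkvar R γ => .mkvar R γ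

/-- Simultaneous capture-avoiding substitution. -/
def Hd.subst (s : ℕ → Nf) : Hd → Hd
  | .ret t => .ret (t.subst (upSubst s))
  | .op h o t => .op (h.subst s) o (t.subst (upSubst (upSubst s)))

end

/-- `t[n/x]`, where `x` is variable `0`. -/
def Tm.inst (t : Tm) (n : Nf) : Tm := t.subst (scons n .var)

/-- `t[n/x, k/y]`, where `y` is variable `0` and `x` is variable `1`. -/
def Tm.inst₂ (t : Tm) (n k : Nf) : Tm := t.subst (scons k (scons n .var))

/-- The body of the return clause of a handler. -/
def Hd.retBody : Hd → Tm
  | .ret t => t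
  | .op h _ _ => h.retBody

/-- The operations that a handler has clauses for. -/
def Hd.dom : Hd → Finset OpName
  | .ret _ => ∅
  | .op h o _ => insert o h.dom

/-- `h.HasClause o t`: the clause `o(x, k) ↦ t` is in `h`. -/
inductive Hd.HasClause : Hd → OpName → Tm → Prop
  | here {h : Hd} {o : OpName} {t : Tm} : (Hd.op h o t).HasClause o t
  | there {h : Hd} {o o' : OpName} {t t' : Tm} : h.HasClause o t → (Hd.op h o' t').HasClause o t

/-- Evaluation frames `do x ← [-] in t` and `handle [-] with h`. -/
inductive Frame : Type
  | bind : Tm → Frame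
  | handle : Hd → Frame

/-- `F[t]` -/
def Frame.fill : Frame → Tm → Tm
  | .bind t₂, t => .bind t t₂
  | .handle h, t => .handle t h

/-- Renaming of variables. -/
def Frame.rename (r : ℕ → ℕ) : Frame → Frame
  | .bind t => .bind (t.rename (upRen r))
  | .handle h => .handle (h.rename r)

/-- Evaluation contexts, as stacks of frames, the innermost one first. Thus `E[F]` is `F :: E`, and
`E₁[E₂]` is `E₂ ++ E₁`. -/
abbrev EvCtx := List Frame

/-- `E[t]` -/
def EvCtx.plug : EvCtx → Tm → Tm
  | [], t => t
  | F :: E, t => EvCtx.plug E (F.fill t)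

/-- The operations handled by an evaluation context. -/
def EvCtx.handled : EvCtx → Finset OpName
  | [] => ∅
  | .bind _ :: E => EvCtx.handled E
  | .handle h :: E => EvCtx.handled E ∪ h.dom

/-- `κx. E[return x]`, where `x` is not free in `E`. -/
def EvCtx.reify (E : EvCtx) : Nf :=
  .kappa (EvCtx.plug (E.map (Frame.rename Nat.succ)) (.ret (.var 0)))

/-- Configurations `⟨t; E; U⟩`. -/
structure Config where
  tm : Tm
  ctx : EvCtx
  used : Finset ℕ

/-- Reduction of configurations; `next` is the choice of fresh names. -/
inductive Step (next : Finset ℕ → ℕ) : Config → Config → Prop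
  | app (t : Tm) (n : Nf) (E : EvCtx) (U : Finset ℕ) :
      Step next ⟨.app (.lam t) n, E, U⟩ ⟨t.inst n, E, U⟩
  | seq (n : Nf) (t : Tm) (E : EvCtx) (U : Finset ℕ) :
      Step next ⟨.bind (.ret n) t, E, U⟩ ⟨t.inst n, E, U⟩
  | hdl (n : Nf) (h : Hd) (E : EvCtx) (U : Finset ℕ) :
      Step next ⟨.handle (.ret n) h, E, U⟩ ⟨h.retBody.inst n, E, U⟩
  | psh (F : Frame) (t : Tm) (E : EvCtx) (U : Finset ℕ) :
      Step next ⟨F.fill t, E, U⟩ ⟨t, F :: E, U⟩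
  | pop (n : Nf) (F : Frame) (E : EvCtx) (U : Finset ℕ) :
      Step next ⟨.ret n, F :: E, U⟩ ⟨F.fill (.ret n), E, U⟩
  | gen (R : PreTy) (γ : Cls) (E : EvCtx) (U : Finset ℕ) :
      Step next ⟨.mkvar R γ, E, U⟩ ⟨.ret (.param ⟨next U, R, γ⟩), E, insert (next U) U⟩
  | op (o : OpName) (n : Nf) (E₁ E₂ : EvCtx) (h : Hd) (t : Tm) (U : Finset ℕ) :
      h.HasClause o t → o ∉ EvCtx.handled E₂ →
      Step next ⟨.op o n, E₂ ++ .handle h :: E₁, U⟩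
        ⟨t.inst₂ n (EvCtx.reify (E₂ ++ [.handle h])), E₁, U⟩
  | cnt (E₁ E₂ : EvCtx) (n : Nf) (U : Finset ℕ) :
      Step next ⟨.continue (EvCtx.reify E₂) n, E₁, U⟩ ⟨.ret n, E₂ ++ E₁, U⟩

/-- `→*` -/
def Steps (next : Finset ℕ → ℕ) : Config → Config → Prop := Relation.ReflTransGen (Step next)

/-- The formal parameter that a normal form is, if it is one. -/
def Nf.params : Nf → Set Param
  | .param a => {a}
  | _ => ∅

mutual

/-- The free `Var`s of a normal form. `Lam`, `Do` and the handler nodes bind formal parameters. -/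
def Nf.fvs : Nf → Set Param
  | .var _ => ∅
  | .nat _ => ∅
  | .lam t => t.fvs
  | .kappa t => t.fvs
  | .param _ => ∅
  | .astNat _ => ∅
  | .astVar n => n.params ∪ n.fvs
  | .astLam n₁ n₂ => n₁.fvs ∪ (n₂.fvs \ n₁.params)
  | .astApp n₁ n₂ => n₁.fvs ∪ n₂.fvs
  | .astContinue n₁ n₂ => n₁.fvs ∪ n₂.fvs
  | .astRet n => n.fvs
  | .astDo n₁ n₂ n₃ => n₁.fvs ∪ n₂.fvs ∪ (n₃.fvs \ n₂.params)
  | .astOp _ n => n.fvs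
  | .astHandle n₁ n₂ => n₁.fvs ∪ n₂.fvs
  | .astHret n₁ n₂ => n₁.fvs ∪ (n₂.fvs \ n₁.params)
  | .astHop _ n₁ n₂ n₃ n₄ =>
      n₁.fvs ∪ n₂.fvs ∪ n₃.fvs ∪ (n₄.fvs \ (n₂.params ∪ n₃.params))

/-- The free `Var`s of a term. -/
def Tm.fvs : Tm → Set Param
  | .app n₁ n₂ => n₁.fvs ∪ n₂.fvs
  | .ret n => n.fvs
  | .bind t₁ t₂ => t₁.fvs ∪ t₂.fvs
  | .op _ n => n.fvs
  | .handle t h => t.fvs ∪ h.fvs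
  | .continue n₁ n₂ => n₁.fvs ∪ n₂.fvs
  | .mkvar _ _ => ∅

/-- The free `Var`s of a handler. -/
def Hd.fvs : Hd → Set Param
  | .ret t => t.fvs
  | .op h _ t => h.fvs ∪ t.fvs

end

/-! ### Elaboration

The administrative binders of the elaboration bind fresh variables: the subterms under them are
renamed accordingly. Since no marker is inserted for top-level splices, the elaborations in modes `c`
and `q` have the same equations. -/

/-- Erasure of level `0` types to run-time pre-types. -/
def Ty0.erase : Ty0 → PreTy
  | .nat => .nat
  | .fn S ξ T => .fn S.erase ξ T.erase
  | .cont S ξ T => .cont S.erase ξ T.erase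

/-- `mkvar` at an annotation; the type is erased, the classifier is not. -/
def Ann.mkvar (a : Ann) : Tm := .mkvar a.ty.erase a.cls

mutual

/-- `⟦v⟧_{c|q}` -/
def Val0.elaborate : Val0 → Tm
  | .var i => .ret (.astVar (.var i))
  | .nat m => .ret (.astNat m)
  | .lam a e => .bind a.mkvar (.bind e.elaborate (.ret (.astLam (.var 1) (.var 0))))

/-- `⟦e⟧_{c|q}` -/
def Exp0.elaborate : Exp0 → Tm
  | .app v₁ v₂ =>
      .bind v₁.elaborate (.bind (v₂.elaborate.rename Nat.succ) (.ret (.astApp (.var 1) (.var 0))))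
  | .ret v => .bind v.elaborate (.ret (.astRet (.var 0)))
  | .bind a e₁ e₂ =>
      .bind e₁.elaborate (.bind a.mkvar (.bind (e₂.elaborate.rename (upRen Nat.succ))
        (.ret (.astDo (.var 2) (.var 1) (.var 0)))))
  | .op o v => .bind v.elaborate (.ret (.astOp o (.var 0)))
  | .handle e h =>
      .bind e.elaborate (.bind (h.elaborate.rename Nat.succ)
        (.ret (.astHandle (.var 1) (.var 0))))
  | .continue v₁ v₂ =>
      .bind v₁.elaborate (.bind (v₂.elaborate.rename Nat.succ)
        (.ret (.astContinue (.var 1) (.var 0))))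
  | .splice e => e.elaborate

/-- `⟦h⟧_{c|q}` -/
def Hdl0.elaborate : Hdl0 → Tm
  | .ret a e => .bind a.mkvar (.bind e.elaborate (.ret (.astHret (.var 1) (.var 0))))
  | .op h o a k e =>
      .bind h.elaborate (.bind a.mkvar (.bind k.mkvar
        (.bind (e.elaborate.rename (upRen (upRen Nat.succ)))
          (.ret (.astHop o (.var 3) (.var 2) (.var 1) (.var 0))))))

/-- `⟦v⟧_s` -/
def ValM.elaborate : ValM → Nf
  | .var i => .var i
  | .nat m => .nat m
  | .lam e => .lam e.elaborate

/-- `⟦e⟧_s` -/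
def ExpM.elaborate : ExpM → Tm
  | .app v₁ v₂ => .app v₁.elaborate v₂.elaborate
  | .ret v => .ret v.elaborate
  | .bind e₁ e₂ => .bind e₁.elaborate e₂.elaborate
  | .op o v => .op o v.elaborate
  | .handle e h => .handle e.elaborate h.elaborate
  | .continue v₁ v₂ => .continue v₁.elaborate v₂.elaborate
  | .quote e => e.elaborate

/-- `⟦h⟧_s` -/
def HdlM.elaborate : HdlM → Hd
  | .ret e => .ret e.elaborate
  | .op h o e => .op h.elaborate o e.elaborate

end

end RefinedClassifiers

open RefinedClassifiers

/-!
The proof is by a logical relation on the core language. Nothing about the types of the generated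
code matters, only its free `Var`s, so a `Code` type of classifier `γ` is interpreted as the set of
normal forms whose free `Var`s are in a set of formal parameters assigned to `γ` (`TyM.sem`).
Classifiers thus act as type variables: entering a level `0` binder interprets its new classifier
by the set of the enclosing scope together with the generated parameter, and leaving it removes this
parameter again, as the AST binder does. At `γ⊥` the set is empty.

Expressions are interpreted by `Exec`: running them ends in a value of the expected kind, or in an
unhandled call of an operation in the effect set, with a good argument and resumable with every good
result. Handlers are dealt with by induction on such executions (`Exec.handleFrame`). What good
arguments and results are depends on the classifiers in the type of the operation. If these are not
all in scope, no handler in the current scope can catch the call, and the interpretation is the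
trivial one (`ClsEnv.interp`); this is what lets an effect set leave the scope of a binder
(`Exec.leaveScope`) and prevents scope extrusion. If all the classifiers of a type are in scope, its
interpretation does not change when further scopes are entered (`ClsEnv.AgreeOn.sem_iff`).

Interpreting an operation requires the interpretation of its argument type, whose effect sets may
contain the operation itself. The relation is therefore indexed by a `Clock`, and the recursion
descends along `CallLt`: either the index decreases with each step, or the operations decrease in the
dependency order of the signature. The first gives a step-indexed relation, from which safety follows
for every signature (`Exec.step`, `Exec.progress`); for the second, a single index suffices, and
executions are finite (`Exec.terminates`). Both are instances of the same fundamental theorem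
(`TyExp0.sound` and the statements proved with it).
-/

namespace RefinedClassifiers

/-! ### Renaming and substitution -/

/-- Simultaneous induction on normal forms, terms and handlers. -/
theorem syntax_induction {P : Nf → Prop} {Q : Tm → Prop} {R : Hd → Prop}
    (var : ∀ i, P (.var i)) (nat : ∀ m, P (.nat m)) (lam : ∀ t, Q t → P (.lam t))
    (kappa : ∀ t, Q t → P (.kappa t)) (param : ∀ a, P (.param a)) (astNat : ∀ m, P (.astNat m))
    (astVar : ∀ n, P n → P (.astVar n)) (astLam : ∀ n₁ n₂, P n₁ → P n₂ → P (.astLam n₁ n₂))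
    (astApp : ∀ n₁ n₂, P n₁ → P n₂ → P (.astApp n₁ n₂))
    (astContinue : ∀ n₁ n₂, P n₁ → P n₂ → P (.astContinue n₁ n₂))
    (astRet : ∀ n, P n → P (.astRet n))
    (astDo : ∀ n₁ n₂ n₃, P n₁ → P n₂ → P n₃ → P (.astDo n₁ n₂ n₃))
    (astOp : ∀ o n, P n → P (.astOp o n))
    (astHandle : ∀ n₁ n₂, P n₁ → P n₂ → P (.astHandle n₁ n₂))
    (astHret : ∀ n₁ n₂, P n₁ → P n₂ → P (.astHret n₁ n₂))
    (astHop : ∀ o n₁ n₂ n₃ n₄, P n₁ → P n₂ → P n₃ → P n₄ → P (.astHop o n₁ n₂ n₃ n₄))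
    (app : ∀ n₁ n₂, P n₁ → P n₂ → Q (.app n₁ n₂)) (ret : ∀ n, P n → Q (.ret n))
    (bind : ∀ t₁ t₂, Q t₁ → Q t₂ → Q (.bind t₁ t₂)) (op : ∀ o n, P n → Q (.op o n))
    (handle : ∀ t h, Q t → R h → Q (.handle t h))
    (cont : ∀ n₁ n₂, P n₁ → P n₂ → Q (.continue n₁ n₂)) (mkvar : ∀ T γ, Q (.mkvar T γ))
    (hret : ∀ t, Q t → R (.ret t)) (hop : ∀ h o t, R h → Q t → R (.op h o t)) :
    (∀ n, P n) ∧ (∀ t, Q t) ∧ ∀ h, R h := by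
  refine ⟨fun n => ?_, fun t => ?_, fun h => ?_⟩
  · apply Nf.rec (motive_1 := P) (motive_2 := Q) (motive_3 := R) <;> assumption
  · apply Tm.rec (motive_1 := P) (motive_2 := Q) (motive_3 := R) <;> assumption
  · apply Hd.rec (motive_1 := P) (motive_2 := Q) (motive_3 := R) <;> assumption

theorem upRen_comp (r r' : ℕ → ℕ) : (fun i => upRen r' (upRen r i)) = upRen fun i => r' (r i) := by
  funext i; cases i <;> rfl

theorem upSubst_upRen (s : ℕ → Nf) (r : ℕ → ℕ) :
    (fun i => upSubst s (upRen r i)) = upSubst fun i => s (r i) := by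
  funext i; cases i <;> rfl

theorem upSubst_var : upSubst Nf.var = Nf.var := by
  funext i; cases i <;> rfl

theorem rename_rename :
    (∀ n : Nf, ∀ r r', (n.rename r).rename r' = n.rename fun i => r' (r i)) ∧
    (∀ t : Tm, ∀ r r', (t.rename r).rename r' = t.rename fun i => r' (r i)) ∧
    (∀ h : Hd, ∀ r r', (h.rename r).rename r' = h.rename fun i => r' (r i)) := by
  apply syntax_induction <;> intros <;>
    simp_all only [Nf.rename, Tm.rename, Hd.rename, upRen_comp]

theorem rename_subst :
    (∀ n : Nf, ∀ r s, (n.rename r).subst s = n.subst fun i => s (r i)) ∧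
    (∀ t : Tm, ∀ r s, (t.rename r).subst s = t.subst fun i => s (r i)) ∧
    (∀ h : Hd, ∀ r s, (h.rename r).subst s = h.subst fun i => s (r i)) := by
  apply syntax_induction <;> intros <;>
    simp_all only [Nf.rename, Tm.rename, Hd.rename, Nf.subst, Tm.subst, Hd.subst, upSubst_upRen]

theorem subst_var :
    (∀ n : Nf, n.subst .var = n) ∧ (∀ t : Tm, t.subst .var = t) ∧
    (∀ h : Hd, h.subst .var = h) := by
  apply syntax_induction <;> intros <;> simp_all only [Nf.subst, Tm.subst, Hd.subst, upSubst_var]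

theorem upSubst_rename (s : ℕ → Nf) (r : ℕ → ℕ) :
    (fun i => (upSubst s i).rename (upRen r)) = upSubst fun i => (s i).rename r := by
  funext i
  cases i with
  | zero => rfl
  | succ i => simp only [upSubst, scons, rename_rename.1]; rfl

theorem subst_rename :
    (∀ n : Nf, ∀ s r, (n.subst s).rename r = n.subst fun i => (s i).rename r) ∧
    (∀ t : Tm, ∀ s r, (t.subst s).rename r = t.subst fun i => (s i).rename r) ∧
    (∀ h : Hd, ∀ s r, (h.subst s).rename r = h.subst fun i => (s i).rename r) := by
  apply syntax_induction <;> intros <;>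
    simp_all only [Nf.rename, Tm.rename, Hd.rename, Nf.subst, Tm.subst, Hd.subst, upSubst_rename]

theorem upSubst_subst (s s' : ℕ → Nf) :
    (fun i => (upSubst s i).subst (upSubst s')) = upSubst fun i => (s i).subst s' := by
  funext i
  cases i with
  | zero => rfl
  | succ i => simp only [upSubst, scons, rename_subst.1, subst_rename.1]

theorem subst_subst :
    (∀ n : Nf, ∀ s s', (n.subst s).subst s' = n.subst fun i => (s i).subst s') ∧
    (∀ t : Tm, ∀ s s', (t.subst s).subst s' = t.subst fun i => (s i).subst s') ∧
    (∀ h : Hd, ∀ s s', (h.subst s).subst s' = h.subst fun i => (s i).subst s') := by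
  apply syntax_induction <;> intros <;> simp_all only [Nf.subst, Tm.subst, Hd.subst, upSubst_subst]

theorem Nf.rename_succ_subst (n k : Nf) (s : ℕ → Nf) :
    (n.rename Nat.succ).subst (scons k s) = n.subst s :=
  rename_subst.1 _ _ _

theorem Tm.rename_succ_subst (t : Tm) (k : Nf) (s : ℕ → Nf) :
    (t.rename Nat.succ).subst (scons k s) = t.subst s :=
  rename_subst.2.1 _ _ _

theorem Tm.subst_inst (t : Tm) (s : ℕ → Nf) (n : Nf) :
    (t.subst (upSubst s)).inst n = t.subst (scons n s) := by
  rw [Tm.inst, subst_subst.2.1]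
  congr 1
  funext i
  cases i with
  | zero => rfl
  | succ i => exact (Nf.rename_succ_subst _ _ _).trans (subst_var.1 _)

theorem Tm.subst_inst₂ (t : Tm) (s : ℕ → Nf) (n k : Nf) :
    (t.subst (upSubst (upSubst s))).inst₂ n k = t.subst (scons k (scons n s)) := by
  rw [Tm.inst₂, subst_subst.2.1]
  congr 1
  funext i
  rcases i with _ | _ | i
  · rfl
  · rfl
  · simp only [upSubst, scons, Nf.rename_succ_subst, subst_var.1]

theorem Hd.retBody_subst (h : Hd) (s : ℕ → Nf) :
    (h.subst s).retBody = h.retBody.subst (upSubst s) := by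
  cases h with
  | ret t => rfl
  | op h o t => exact Hd.retBody_subst h s

theorem Hd.dom_subst (h : Hd) (s : ℕ → Nf) : (h.subst s).dom = h.dom := by
  cases h with
  | ret t => rfl
  | op h o t => simp only [Hd.subst, Hd.dom, Hd.dom_subst h s]

theorem Hd.HasClause.mem_dom {h : Hd} {o : OpName} {t : Tm} (hc : h.HasClause o t) : o ∈ h.dom := by
  induction hc <;> simp_all [Hd.dom]

theorem Hd.exists_hasClause {h : Hd} {o : OpName} (ho : o ∈ h.dom) : ∃ t, h.HasClause o t := by
  cases h with
  | ret t => simp [Hd.dom] at ho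
  | op h o' t =>
    rcases Finset.mem_insert.1 ho with rfl | ho
    · exact ⟨t, .here⟩
    · obtain ⟨t, ht⟩ := Hd.exists_hasClause ho
      exact ⟨t, .there ht⟩

/-! ### Evaluation contexts -/

theorem EvCtx.handled_append (E E' : EvCtx) :
    EvCtx.handled (E ++ E') = EvCtx.handled E ∪ EvCtx.handled E' := by
  induction E with
  | nil => simp [EvCtx.handled]
  | cons F E ih =>
    cases F <;> simp only [EvCtx.handled, List.cons_append, ih]
    ext; simp only [Finset.mem_union]; tauto

/-- The innermost handler for an operation in an evaluation context is unique. -/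
theorem EvCtx.split_unique {o : OpName} {E₂ E₂' E₁ E₁' : EvCtx} {h h' : Hd}
    (heq : E₂ ++ .handle h :: E₁ = E₂' ++ .handle h' :: E₁') (ho : o ∈ h.dom) (ho' : o ∈ h'.dom)
    (hn : o ∉ EvCtx.handled E₂) (hn' : o ∉ EvCtx.handled E₂') :
    E₂ = E₂' ∧ h = h' ∧ E₁ = E₁' := by
  induction E₂ generalizing E₂' with
  | nil =>
    cases E₂' with
    | nil => simpa using heq
    | cons F E =>
      obtain ⟨rfl, rfl⟩ : .handle h = F ∧ E₁ = E ++ .handle h' :: E₁' := by simpa using heq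
      simp [EvCtx.handled, ho] at hn'
  | cons F E ih =>
    cases E₂' with
    | nil =>
      obtain ⟨rfl, rfl⟩ : F = .handle h' ∧ E ++ .handle h :: E₁ = E₁' := by simpa using heq
      simp [EvCtx.handled, ho'] at hn
    | cons F' E' =>
      obtain ⟨rfl, heq'⟩ : F = F' ∧ E ++ .handle h :: E₁ = E' ++ .handle h' :: E₁' := by
        simpa using heq
      have hE : o ∉ EvCtx.handled E ∧ o ∉ EvCtx.handled E' := by
        cases F <;> simp_all [EvCtx.handled]
      obtain ⟨rfl, rfl, rfl⟩ := ih heq' hE.1 hE.2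
      exact ⟨rfl, rfl, rfl⟩

/-- The evaluation context and the redex of a term, on top of a given evaluation context. -/
def Tm.focus : Tm → EvCtx → EvCtx × Tm
  | .bind t₁ t₂, E => t₁.focus (.bind t₂ :: E)
  | .handle t h, E => t.focus (.handle h :: E)
  | t, E => (E, t)

theorem EvCtx.focus_plug (E K : EvCtx) (t : Tm) :
    (EvCtx.plug E t).focus K = t.focus (E ++ K) := by
  induction E generalizing t with
  | nil => rfl
  | cons F E ih => cases F <;> simp only [EvCtx.plug, ih, Frame.fill, Tm.focus, List.cons_append]

theorem Frame.rename_succ_injective : Function.Injective (Frame.rename Nat.succ) := by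
  -- `upRen succ` and `succ` are undone by substitutions that map these indices back.
  have undo : ∀ i, scons (.var 0) (scons (.var 0) fun i => .var (i + 1)) (upRen Nat.succ i)
      = Nf.var i := by
    intro i; cases i <;> rfl
  intro F F' h
  cases F with
  | bind t =>
    cases F' with
    | bind t' =>
      have h := congrArg (Tm.subst (scons (.var 0) (scons (.var 0) fun i => .var (i + 1))))
        (Frame.bind.inj h)
      simp only [rename_subst.2.1, undo] at h
      rw [show (fun i => Nf.var i) = Nf.var from rfl, subst_var.2.1, subst_var.2.1] at h
      rw [h]
    | handle => simp [Frame.rename] at h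
  | handle H =>
    cases F' with
    | bind t => simp [Frame.rename] at h
    | handle H' =>
      have h := congrArg (Hd.subst (scons (.var 0) .var)) (Frame.handle.inj h)
      simp only [rename_subst.2.2, scons] at h
      rw [show (fun i => Nf.var i) = Nf.var from rfl, subst_var.2.2, subst_var.2.2] at h
      rw [h]

/-- A reified continuation determines its evaluation context, so that `continue` is deterministic. -/
theorem EvCtx.reify_injective : Function.Injective EvCtx.reify := by
  intro E E' h
  have h := congrArg (fun t => (Tm.focus t []).1) (Nf.kappa.inj h)
  simp only [EvCtx.focus_plug, Tm.focus, List.append_nil] at h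
  exact List.map_injective_iff.2 Frame.rename_succ_injective h

/-! ### Executions -/

/-- The indices of the logical relation. `later w w'` says that a reduction step may lead from index
`w` to index `w'`. With `ℕ` and `>`, an index bounds the number of steps that are observed, which
gives safety; with one index and the total relation, executions are finite. -/
class Clock (W : Type) extends Preorder W where
  later : W → W → Prop
  le_of_later {w w' : W} : later w w' → w' ≤ w
  later_of_le {w v w' : W} : w ≤ v → later w w' → later v w'
  later_of_later_of_le {w v w' : W} : later w v → w' ≤ v → later w w'

open Clock

theorem forall_le_of_later {W : Type} [Clock W] {w w' : W} {P : W → Prop} (h : later w w')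
    (hP : ∀ v ≤ w, P v) : ∀ v ≤ w', P v :=
  fun v hv => hP v (hv.trans (le_of_later h))

/-- An interpretation of the compile-time operations: the arguments that they may be called with, and
the results that they may be resumed with. -/
structure OpInterp (W : Type) where
  arg : OpName → W → Nf → Prop
  res : OpName → Nf → Prop

section Exec

variable {W : Type} [Clock W]

/-- `Exec I Δ Q w t E`: at index `w`, running the term `t` in the evaluation context `E` ends in a
value that satisfies `Q` with an empty evaluation context, or in a call that `E` does not handle of
an operation in `Δ`, whose argument is as `I` says and which can be resumed with every result that
`I` allows. If an index without later ones is reached before, nothing more is said about the run.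
Fresh formal parameters are arbitrary. -/
inductive Exec (I : OpInterp W) (Δ : Finset OpName) (Q : W → Nf → Prop) :
    W → Tm → EvCtx → Prop
  | ret {w : W} {n : Nf} : Q w n → Exec I Δ Q w (.ret n) []
  | pushBind {w : W} {t t' : Tm} {E : EvCtx} :
      Exec I Δ Q w t (.bind t' :: E) → Exec I Δ Q w (.bind t t') E
  | pushHandle {w : W} {t : Tm} {h : Hd} {E : EvCtx} :
      Exec I Δ Q w t (.handle h :: E) → Exec I Δ Q w (.handle t h) E
  | app {w : W} {t : Tm} {n : Nf} {E : EvCtx} :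
      (∀ w', later w w' → Exec I Δ Q w' (t.inst n) E) → Exec I Δ Q w (.app (.lam t) n) E
  | seq {w : W} {t : Tm} {n : Nf} {E : EvCtx} :
      (∀ w', later w w' → Exec I Δ Q w' (t.inst n) E) → Exec I Δ Q w (.ret n) (.bind t :: E)
  | hdl {w : W} {h : Hd} {n : Nf} {E : EvCtx} :
      (∀ w', later w w' → Exec I Δ Q w' (h.retBody.inst n) E) →
      Exec I Δ Q w (.ret n) (.handle h :: E)
  | gen {w : W} {R : PreTy} {γ : Cls} {E : EvCtx} :
      (∀ α w', later w w' → Exec I Δ Q w' (.ret (.param α)) E) → Exec I Δ Q w (.mkvar R γ) E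
  | cnt {w : W} {n : Nf} {E E' : EvCtx} :
      (∀ w', later w w' → Exec I Δ Q w' (.ret n) (E' ++ E)) →
      Exec I Δ Q w (.continue (EvCtx.reify E') n) E
  | op {w : W} {o : OpName} {n : Nf} {h : Hd} {E E₁ E₂ : EvCtx} :
      E = E₂ ++ .handle h :: E₁ → o ∈ h.dom → o ∉ EvCtx.handled E₂ →
      (∀ t w', h.HasClause o t → later w w' →
        Exec I Δ Q w' (t.inst₂ n (EvCtx.reify (E₂ ++ [.handle h]))) E₁) →
      Exec I Δ Q w (.op o n) E
  | call {w : W} {o : OpName} {n : Nf} {E : EvCtx} :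
      o ∈ Δ → o ∉ EvCtx.handled E → I.arg o w n →
      (∀ n', I.res o n' → Exec I Δ Q w (.ret n') E) → Exec I Δ Q w (.op o n) E

theorem Exec.mono {I : OpInterp W} {Δ : Finset OpName} {Q : W → Nf → Prop} {w w' : W} {t : Tm}
    {E : EvCtx} (hI : ∀ o w w' n, w' ≤ w → I.arg o w n → I.arg o w' n)
    (hQ : ∀ w w' n, w' ≤ w → Q w n → Q w' n) (hw : w' ≤ w) (H : Exec I Δ Q w t E) :
    Exec I Δ Q w' t E := by
  induction H with
  | ret h => exact .ret (hQ _ _ _ hw h)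
  | pushBind _ ih => exact .pushBind (ih hw)
  | pushHandle _ ih => exact .pushHandle (ih hw)
  | app h _ => exact .app fun v hv => h v (later_of_le hw hv)
  | seq h _ => exact .seq fun v hv => h v (later_of_le hw hv)
  | hdl h _ => exact .hdl fun v hv => h v (later_of_le hw hv)
  | gen h _ => exact .gen fun α v hv => h α v (later_of_le hw hv)
  | cnt h _ => exact .cnt fun v hv => h v (later_of_le hw hv)
  | op hE ho hn h _ => exact .op hE ho hn fun t v ht hv => h t v ht (later_of_le hw hv)
  | call ho hn ha _ ih => exact .call ho hn (hI _ _ _ _ hw ha) fun n' hn' => ih n' hn' hw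

/-- Executions are monotone in the interpretation of the operations in the effect set, contravariantly
in their results, and in the postcondition, at the indices below the current one. -/
theorem Exec.imp {I I' : OpInterp W} {Δ : Finset OpName} {Q Q' : W → Nf → Prop} {w : W} {t : Tm}
    {E : EvCtx} (H : Exec I Δ Q w t E)
    (hI : ∀ o ∈ Δ, ∀ w' ≤ w, ∀ n, I.arg o w' n → I'.arg o w' n)
    (hres : ∀ o ∈ Δ, ∀ n, I'.res o n → I.res o n)
    (hQ : ∀ w' ≤ w, ∀ n, Q w' n → Q' w' n) : Exec I' Δ Q' w t E := by
  induction H with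
  | ret h => exact .ret (hQ _ le_rfl _ h)
  | pushBind _ ih => exact .pushBind (ih hI hQ)
  | pushHandle _ ih => exact .pushHandle (ih hI hQ)
  | app _ ih =>
    exact .app fun v hv => ih v hv (fun o ho => forall_le_of_later hv (hI o ho))
      (forall_le_of_later hv hQ)
  | seq _ ih =>
    exact .seq fun v hv => ih v hv (fun o ho => forall_le_of_later hv (hI o ho))
      (forall_le_of_later hv hQ)
  | hdl _ ih =>
    exact .hdl fun v hv => ih v hv (fun o ho => forall_le_of_later hv (hI o ho))
      (forall_le_of_later hv hQ)
  | gen _ ih =>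
    exact .gen fun α v hv => ih α v hv (fun o ho => forall_le_of_later hv (hI o ho))
      (forall_le_of_later hv hQ)
  | cnt _ ih =>
    exact .cnt fun v hv => ih v hv (fun o ho => forall_le_of_later hv (hI o ho))
      (forall_le_of_later hv hQ)
  | op hE ho hn _ ih =>
    exact .op hE ho hn fun t v ht hv =>
      ih t v ht hv (fun o ho => forall_le_of_later hv (hI o ho)) (forall_le_of_later hv hQ)
  | call ho hn ha _ ih =>
    exact .call ho hn (hI _ ho _ le_rfl _ ha) fun n' hn' => ih n' (hres _ ho _ hn') hI hQ

/-- A `do` frame handles nothing, so calls pass through it. -/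
theorem Exec.bindFrame {I : OpInterp W} {Δ : Finset OpName} {Q Q' : W → Nf → Prop} {w : W}
    {t t' : Tm} {E : EvCtx} (H : Exec I Δ Q w t E)
    (H' : ∀ w' ≤ w, ∀ n, Q w' n → Exec I Δ Q' w' (.ret n) [.bind t']) :
    Exec I Δ Q' w t (E ++ [.bind t']) := by
  induction H with
  | ret h => exact H' _ le_rfl _ h
  | pushBind _ ih => exact .pushBind (ih H')
  | pushHandle _ ih => exact .pushHandle (ih H')
  | app _ ih => exact .app fun v hv => ih v hv (forall_le_of_later hv H')
  | seq _ ih => exact .seq fun v hv => ih v hv (forall_le_of_later hv H')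
  | hdl _ ih => exact .hdl fun v hv => ih v hv (forall_le_of_later hv H')
  | gen _ ih => exact .gen fun α v hv => ih α v hv (forall_le_of_later hv H')
  | cnt _ ih => exact .cnt fun v hv => by simpa using ih v hv (forall_le_of_later hv H')
  | op hE ho hn _ ih =>
    exact .op (by rw [hE, List.append_assoc]; rfl) ho hn fun t v ht hv =>
      ih t v ht hv (forall_le_of_later hv H')
  | call ho hn ha _ ih =>
    refine .call ho ?_ ha fun n' hn' => ih n' hn' H'
    simpa [EvCtx.handled_append, EvCtx.handled] using hn

theorem Exec.bind {I : OpInterp W} {Δ : Finset OpName} {Q Q' : W → Nf → Prop} {w : W} {t t' : Tm}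
    (H : Exec I Δ Q w t []) (hQ : ∀ w w' n, w' ≤ w → Q w n → Q w' n)
    (H' : ∀ w' ≤ w, ∀ n, Q w' n → Exec I Δ Q' w' (t'.inst n) []) :
    Exec I Δ Q' w (.bind t t') [] :=
  .pushBind <| H.bindFrame fun _ hw _ hn =>
    .seq fun _ hv => H' _ ((le_of_later hv).trans hw) _ (hQ _ _ _ (le_of_later hv) hn)

/-- A deep handler turns executions of the handled term into executions of its own: the captured
continuation contains the handler, so it is again covered by the induction hypothesis. -/
theorem Exec.handleFrame {I : OpInterp W} {Δ₁ Δ₂ : Finset OpName} {Q Q' : W → Nf → Prop} {w : W}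
    {t : Tm} {h : Hd} {E : EvCtx} (H : Exec I Δ₁ Q w t E)
    (hdom : ∀ o ∈ Δ₁ \ Δ₂, o ∈ h.dom)
    (hI : ∀ o w w' n, w' ≤ w → I.arg o w n → I.arg o w' n)
    (hQ : ∀ w w' n, w' ≤ w → Q w n → Q w' n)
    (hQ' : ∀ w w' n, w' ≤ w → Q' w n → Q' w' n)
    (hret : ∀ w' ≤ w, ∀ n, Q w' n → Exec I Δ₂ Q' w' (h.retBody.inst n) [])
    (hop : ∀ w' ≤ w, ∀ o ∈ Δ₁, ∀ t n E v, h.HasClause o t → I.arg o w' n → later w' v →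
      (∀ v' ≤ v, ∀ n', I.res o n' → Exec I Δ₂ Q' v' (.ret n') E) →
      Exec I Δ₂ Q' v (t.inst₂ n (EvCtx.reify E)) []) :
    Exec I Δ₂ Q' w t (E ++ [.handle h]) := by
  induction H with
  | ret hn => exact .hdl fun v hv => hret v (le_of_later hv) _ (hQ _ _ _ (le_of_later hv) hn)
  | pushBind _ ih => exact .pushBind (ih hret hop)
  | pushHandle _ ih => exact .pushHandle (ih hret hop)
  | app _ ih =>
    exact .app fun v hv => ih v hv (forall_le_of_later hv hret) (forall_le_of_later hv hop)
  | seq _ ih =>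
    exact .seq fun v hv => ih v hv (forall_le_of_later hv hret) (forall_le_of_later hv hop)
  | hdl _ ih =>
    exact .hdl fun v hv => ih v hv (forall_le_of_later hv hret) (forall_le_of_later hv hop)
  | gen _ ih =>
    exact .gen fun α v hv => ih α v hv (forall_le_of_later hv hret) (forall_le_of_later hv hop)
  | cnt _ ih =>
    exact .cnt fun v hv => by
      simpa using ih v hv (forall_le_of_later hv hret) (forall_le_of_later hv hop)
  | op hE ho hn _ ih =>
    exact .op (by rw [hE, List.append_assoc]; rfl) ho hn fun t v ht hv =>
      ih t v ht hv (forall_le_of_later hv hret) (forall_le_of_later hv hop)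
  | @call w o n E ho hn ha _ ih =>
    by_cases hoh : o ∈ h.dom
    · exact .op rfl hoh hn fun t v ht hv => hop _ le_rfl _ ho _ _ _ _ ht ha hv
        fun v' hv' n' hn' =>
          (ih n' hn' hret hop).mono hI hQ' (hv'.trans (le_of_later hv))
    · refine .call ?_ ?_ ha fun n' hn' => ih n' hn' hret hop
      · by_contra hΔ
        exact hoh (hdom o (Finset.mem_sdiff.2 ⟨ho, hΔ⟩))
      · simpa [EvCtx.handled_append, EvCtx.handled] using And.intro hn hoh

end Exec

/-! ### The logical relation -/

/-- The values of a level `-1` type at an index. Code of classifier `γ` is any normal form whose free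
`Var`s are in `val γ`. -/
def TyM.sem {W : Type} [Clock W] (I : OpInterp W) (val : Cls → Set Param) : TyM → W → Nf → Prop
  | .nat, _, _ => True
  | .fn S Δ T, w, n => ∃ t, n = .lam t ∧
      ∀ w' ≤ w, ∀ n', S.sem I val w' n' → Exec I Δ (T.sem I val) w' (t.inst n') []
  | .cont S Δ T, w, n => ∃ E, n = EvCtx.reify E ∧
      ∀ w' ≤ w, ∀ n', S.sem I val w' n' → Exec I Δ (T.sem I val) w' (.ret n') E
  | .code _ _ γ, _, n => n.fvs ⊆ val γ

section Sem

variable {W : Type} [Clock W]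

theorem TyM.sem_mono (I : OpInterp W) (val : Cls → Set Param) (T : TyM) (w w' : W) (n : Nf)
    (hw : w' ≤ w) (h : T.sem I val w n) : T.sem I val w' n := by
  cases T with
  | nat => trivial
  | fn S Δ T => exact h.imp fun t ht => ⟨ht.1, fun v hv => ht.2 v (hv.trans hw)⟩
  | cont S Δ T => exact h.imp fun t ht => ⟨ht.1, fun v hv => ht.2 v (hv.trans hw)⟩
  | code S ξ γ => exact h

/-- The meaning of a type depends only on its classifiers, and on the operations in its effect sets at
the indices below the current one. -/
theorem TyM.sem_congr {I I' : OpInterp W} {val val' : Cls → Set Param} {T : TyM} {w : W}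
    (hI : ∀ o ∈ T.ops, ∀ w' ≤ w, ∀ n, I.arg o w' n ↔ I'.arg o w' n)
    (hres : ∀ o ∈ T.ops, ∀ n, I.res o n ↔ I'.res o n) (hval : ∀ γ ∈ T.cls, val γ = val' γ) (n : Nf) :
    T.sem I val w n ↔ T.sem I' val' w n := by
  have exec {Δ : Finset OpName} {T : TyM} {w w' : W} {t : Tm} {E : EvCtx}
      (hI : ∀ o ∈ Δ, ∀ w' ≤ w, ∀ n, I.arg o w' n ↔ I'.arg o w' n)
      (hres : ∀ o ∈ Δ, ∀ n, I.res o n ↔ I'.res o n) (hw : w' ≤ w)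
      (hT : ∀ w' ≤ w, ∀ n, T.sem I val w' n ↔ T.sem I' val' w' n) :
      Exec I Δ (T.sem I val) w' t E ↔ Exec I' Δ (T.sem I' val') w' t E :=
    ⟨fun H => H.imp (fun o ho v hv n => (hI o ho v (hv.trans hw) n).1)
        (fun o ho n => (hres o ho n).2) fun v hv n => (hT v (hv.trans hw) n).1,
      fun H => H.imp (fun o ho v hv n => (hI o ho v (hv.trans hw) n).2)
        (fun o ho n => (hres o ho n).1) fun v hv n => (hT v (hv.trans hw) n).2⟩
  -- The cases of functions and continuations differ in the witness `t` only.
  induction T generalizing w n with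
  | nat => rfl
  | code S ξ γ => simp [TyM.sem, hval γ (by simp [TyM.cls])]
  | fn S Δ T ihS ihT | cont S Δ T ihS ihT =>
    have hS : ∀ w' ≤ w, ∀ n, S.sem I val w' n ↔ S.sem I' val' w' n := fun w' hw n =>
      ihS (fun o ho v hv => hI o (by simp [TyM.ops, ho]) v (hv.trans hw))
        (fun o ho => hres o (by simp [TyM.ops, ho])) (fun γ hγ => hval γ (by simp [TyM.cls, hγ])) n
    have hT : ∀ w' ≤ w, ∀ n, T.sem I val w' n ↔ T.sem I' val' w' n := fun w' hw n =>
      ihT (fun o ho v hv => hI o (by simp [TyM.ops, ho]) v (hv.trans hw))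
        (fun o ho => hres o (by simp [TyM.ops, ho])) (fun γ hγ => hval γ (by simp [TyM.cls, hγ])) n
    refine exists_congr fun t => and_congr_right fun _ => forall₂_congr fun w' hw =>
      forall_congr' fun n' => imp_congr (hS w' hw n') (exec (fun o ho => hI o ?_)
        (fun o ho => hres o ?_) hw hT) <;> simp [TyM.ops, ho]

end Sem

/-- The classifiers in scope, and for each of them the formal parameters that code of this classifier
may mention. The values outside `dom` play no role. -/
structure ClsEnv where
  dom : Set Cls
  val : Cls → Set Param

/-- All classifiers of the argument and result types of an operation are in scope. -/
def OpScoped (Sg : Sig) (C : Set Cls) (o : OpName) : Prop :=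
  ∀ A B, Sg.comp o = some (A, B) → ∀ γ, Mentions Sg A γ ∨ Mentions Sg B γ → γ ∈ C

/-- The results that an operation can be resumed with: none if its type is ill-scoped. -/
def ClsEnv.opRes (Sg : Sig) (ρ : ClsEnv) (o : OpName) (n : Nf) : Prop :=
  OpScoped Sg ρ.dom o ∧ ∀ A T ξ γ, Sg.comp o = some (A, .code T ξ γ) → n.fvs ⊆ ρ.val γ

/-- The order of the recursion that interprets arguments of operations: a step passes, or the
operation occurs in the type of the other one. -/
def CallLt (Sg : Sig) (W : Type) [Clock W] (p q : W × OpName) : Prop :=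
  later q.1 p.1 ∧ Sg.Dep p.2 q.2

open Classical in
/-- The arguments that an operation may be called with: all if its type is ill-scoped. -/
noncomputable def ClsEnv.opArg {Sg : Sig} {W : Type} [Clock W] (hwf : WellFounded (CallLt Sg W))
    (ρ : ClsEnv) : W × OpName → Nf → Prop :=
  hwf.fix fun p rec n => OpScoped Sg ρ.dom p.2 → ∀ A B, Sg.comp p.2 = some (A, B) →
    ∀ w', later p.1 w' →
      A.sem ⟨fun o v n => ∃ h : CallLt Sg W (v, o) p, rec (v, o) h n, ρ.opRes Sg⟩ ρ.val w' n

/-- The interpretation of the operations in an environment. An operation with an ill-scoped type may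
be called with every argument and is never resumed, so that a scope can be left with calls in the
effect set of operations whose types mention the classifier of this scope: no handler outside of the
scope can handle them. -/
noncomputable def ClsEnv.interp {Sg : Sig} {W : Type} [Clock W] (hwf : WellFounded (CallLt Sg W))
    (ρ : ClsEnv) : OpInterp W :=
  ⟨fun o w => ρ.opArg hwf (w, o), ρ.opRes Sg⟩

section Interp

variable {Sg : Sig} {W : Type} [Clock W] {hwf : WellFounded (CallLt Sg W)}

/-- The unfolding of the recursion that defines the interpretation of the operations. -/
theorem ClsEnv.interp_arg_iff {ρ : ClsEnv} {o : OpName} {w : W} {n : Nf} :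
    (ρ.interp hwf).arg o w n ↔ (OpScoped Sg ρ.dom o → ∀ A B, Sg.comp o = some (A, B) →
      ∀ w', later w w' → A.sem (ρ.interp hwf) ρ.val w' n) := by
  change ρ.opArg hwf (w, o) n ↔ _
  rw [ClsEnv.opArg, hwf.fix_eq]
  refine imp_congr_right fun _ => forall₂_congr fun A B => imp_congr_right fun hAB =>
    forall₂_congr fun w' hw => ?_
  refine TyM.sem_congr (fun o' ho' v hv n => ?_) (fun _ _ _ => ?_) (fun _ _ => rfl) n
  swap
  · exact Iff.rfl
  have : CallLt Sg W (v, o') (w, o) :=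
    ⟨later_of_later_of_le hw hv, A, B, hAB, Finset.mem_union_left _ ho'⟩
  exact ⟨fun ⟨_, h⟩ => h, fun h => ⟨this, h⟩⟩

theorem ClsEnv.interp_arg_mono (ρ : ClsEnv) (o : OpName) (w w' : W) (n : Nf) (hw : w' ≤ w)
    (h : (ρ.interp hwf).arg o w n) : (ρ.interp hwf).arg o w' n :=
  interp_arg_iff.2 fun hs A B hAB v hv => interp_arg_iff.1 h hs A B hAB v (later_of_le hw hv)

/-- Two environments agree on a set of classifiers, all of which are in scope in both. -/
def ClsEnv.AgreeOn (ρ ρ' : ClsEnv) (C : Cls → Prop) : Prop :=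
  ∀ γ, C γ → γ ∈ ρ.dom ∧ γ ∈ ρ'.dom ∧ ρ.val γ = ρ'.val γ

theorem ClsEnv.AgreeOn.opRes_iff {ρ ρ' : ClsEnv} {o : OpName}
    (h : ∀ A B, Sg.comp o = some (A, B) → ρ.AgreeOn ρ' fun γ => Mentions Sg A γ ∨ Mentions Sg B γ)
    (n : Nf) : ρ.opRes Sg o n ↔ ρ'.opRes Sg o n := by
  refine and_congr ⟨fun _ A B hAB γ hγ => (h A B hAB γ hγ).2.1,
    fun _ A B hAB γ hγ => (h A B hAB γ hγ).1⟩ ?_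
  refine forall₄_congr fun A T ξ γ => imp_congr_right fun hAB => ?_
  rw [(h _ _ hAB γ (.inr (.here (by simp [TyM.cls])))).2.2]

theorem ClsEnv.AgreeOn.interp_arg_iff {ρ ρ' : ClsEnv} {o : OpName} {w : W}
    (h : ∀ A B, Sg.comp o = some (A, B) → ρ.AgreeOn ρ' fun γ => Mentions Sg A γ ∨ Mentions Sg B γ)
    (n : Nf) : (ρ.interp hwf).arg o w n ↔ (ρ'.interp hwf).arg o w n := by
  obtain ⟨p, hp⟩ : ∃ p, p = (w, o) := ⟨_, rfl⟩
  induction p using hwf.induction generalizing w o n with | _ p ih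
  subst hp
  rw [ClsEnv.interp_arg_iff, ClsEnv.interp_arg_iff]
  refine imp_congr ⟨fun _ A B hAB γ hγ => (h A B hAB γ hγ).2.1,
    fun _ A B hAB γ hγ => (h A B hAB γ hγ).1⟩ ?_
  refine forall₂_congr fun A B => imp_congr_right fun hAB => forall₂_congr fun w' hw => ?_
  have hmen : ∀ o' ∈ A.ops, ∀ A' B', Sg.comp o' = some (A', B') →
      ρ.AgreeOn ρ' fun γ => Mentions Sg A' γ ∨ Mentions Sg B' γ := fun o' ho' A' B' hAB' γ hγ =>
    h A B hAB γ (.inl (hγ.elim (.arg ho' hAB') (.res ho' hAB')))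
  exact TyM.sem_congr
    (fun o' ho' v hv n => ih (v, o') ⟨later_of_later_of_le hw hv, A, B, hAB,
      Finset.mem_union_left _ ho'⟩ (hmen o' ho') n rfl)
    (fun o' ho' => ClsEnv.AgreeOn.opRes_iff (hmen o' ho'))
    (fun γ hγ => (h A B hAB γ (.inl (.here hγ))).2.2) n

theorem ClsEnv.AgreeOn.sem_iff {ρ ρ' : ClsEnv} {T : TyM} (h : ρ.AgreeOn ρ' (Mentions Sg T)) (w : W)
    (n : Nf) : T.sem (ρ.interp hwf) ρ.val w n ↔ T.sem (ρ'.interp hwf) ρ'.val w n := by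
  have hmen : ∀ o ∈ T.ops, ∀ A B, Sg.comp o = some (A, B) →
      ρ.AgreeOn ρ' fun γ => Mentions Sg A γ ∨ Mentions Sg B γ := fun o ho A B hAB γ hγ =>
    h γ (hγ.elim (.arg ho hAB) (.res ho hAB))
  exact TyM.sem_congr (fun o ho v _ => ClsEnv.AgreeOn.interp_arg_iff (hmen o ho))
    (fun o ho => ClsEnv.AgreeOn.opRes_iff (hmen o ho)) (fun γ hγ => (h γ (.here hγ)).2.2) n

/-- The environment in the scope of a level `0` binder: the classifier `γ` of this scope allows the
formal parameters in `X`. -/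
def ClsEnv.extend (ρ : ClsEnv) (γ : Cls) (X : Set Param) : ClsEnv :=
  ⟨insert γ ρ.dom, Function.update ρ.val γ X⟩

theorem ClsEnv.agreeOn_extend {ρ : ClsEnv} {γ : Cls} {X : Set Param} {C : Cls → Prop}
    (hγ : γ ∉ ρ.dom) (hC : ∀ γ', C γ' → γ' ∈ ρ.dom) : ρ.AgreeOn (ρ.extend γ X) C := by
  intro γ' h'
  have hne : γ' ≠ γ := fun h => hγ (h ▸ hC γ' h')
  exact ⟨hC γ' h', .inr (hC γ' h'), (Function.update_of_ne hne _ _).symm⟩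

/-- Leaving the scope of a level `0` binder. -/
theorem Exec.leaveScope {ρ : ClsEnv} {γ : Cls} {X : Set Param} (hγ : γ ∉ ρ.dom)
    {Δ : Finset OpName} {Q : W → Nf → Prop} {w : W} {t : Tm} {E : EvCtx}
    (H : Exec ((ρ.extend γ X).interp hwf) Δ Q w t E) : Exec (ρ.interp hwf) Δ Q w t E := by
  have agree {o : OpName} (ho : OpScoped Sg ρ.dom o) (A B : TyM) (hAB : Sg.comp o = some (A, B)) :
      ρ.AgreeOn (ρ.extend γ X) fun γ => Mentions Sg A γ ∨ Mentions Sg B γ :=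
    ClsEnv.agreeOn_extend hγ (ho A B hAB)
  refine H.imp (fun o _ w' _ n h => ?_) (fun o _ n h => ?_) fun _ _ _ => id
  -- In the ill-scoped case `ρ` allows all arguments, and below no results.
  · by_cases ho : OpScoped Sg ρ.dom o
    · exact (ClsEnv.AgreeOn.interp_arg_iff (agree ho) n).2 h
    · exact ClsEnv.interp_arg_iff.2 fun h => (ho h).elim
  · exact (ClsEnv.AgreeOn.opRes_iff (agree h.1) n).1 h

end Interp

/-! ### Soundness of typing -/

section Sound

variable {Sg : Sig} {W : Type} [Clock W]

/-- The classifier environment `ρ` and the substitution `s` interpret the context `Γ`. The fields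
`bot_mem`, `mem_of_ord` and the memberships in `lv0` and `lvM` are the well-formedness of `Γ`. -/
structure Ctx.Models (hwf : WellFounded (CallLt Sg W)) (Γ : Ctx) (w : W) (ρ : ClsEnv)
    (s : ℕ → Nf) : Prop where
  dom_eq : ρ.dom = Γ.cls
  bot_mem : clsBot ∈ Γ.cls
  val_bot : ∀ γ ∈ Γ.cls, ρ.val clsBot ⊆ ρ.val γ
  mem_of_ord : ∀ {γ γ'}, (γ, γ') ∈ Γ.ord → γ ∈ Γ.cls ∧ γ' ∈ Γ.cls
  val_ord : ∀ {γ γ'}, (γ, γ') ∈ Γ.ord → ρ.val γ ⊆ ρ.val γ'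
  lv0 : ∀ {i T γ}, Γ.vars[i]? = some (.lv0 T γ) → γ ∈ Γ.cls ∧ ∃ α ∈ ρ.val γ, s i = .param α
  lvM : ∀ {i T}, Γ.vars[i]? = some (.lvM T) →
    Γ.Wf Sg T ∧ T.sem (ρ.interp hwf) ρ.val w (s i)

variable {hwf : WellFounded (CallLt Sg W)} {Γ : Ctx} {w : W} {ρ : ClsEnv} {s : ℕ → Nf}

theorem Ctx.Models.mono (h : Γ.Models hwf w ρ s) {w' : W} (hw : w' ≤ w) : Γ.Models hwf w' ρ s :=
  { h with lvM := fun hi => ⟨(h.lvM hi).1, TyM.sem_mono _ _ _ _ _ _ hw (h.lvM hi).2⟩ }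

theorem Ctx.Models.val_mono (h : Γ.Models hwf w ρ s) {γ γ' : Cls} (hle : Γ.Le γ γ') :
    ρ.val γ ⊆ ρ.val γ' := by
  induction hle with
  | refl => rfl
  | bot hγ => exact h.val_bot _ hγ
  | assum ho => exact h.val_ord ho
  | trans _ _ ih ih' => exact ih.trans ih'

theorem Ctx.Models.scope (h : Γ.Models hwf w ρ s) {γ γ' : Cls} (hγ : γ ∈ Γ.cls) (hγ' : γ' ∉ Γ.cls)
    {X : Set Param} (hX : ρ.val γ ⊆ X) : (Γ.scope γ γ').Models hwf w (ρ.extend γ' X) s := by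
  have new : (ρ.extend γ' X).val γ' = X := Function.update_self ..
  have old {γ₁ : Cls} (h₁ : γ₁ ∈ Γ.cls) : (ρ.extend γ' X).val γ₁ = ρ.val γ₁ :=
    Function.update_of_ne (ne_of_mem_of_not_mem h₁ hγ') _ _
  have weak {γ₁ : Cls} (h₁ : γ₁ ∈ Γ.cls) : γ₁ ∈ (Γ.scope γ γ').cls := Finset.mem_insert_of_mem h₁
  have hdom : γ' ∉ ρ.dom := by simpa [h.dom_eq] using hγ'
  refine ⟨by simp [ClsEnv.extend, Ctx.scope, h.dom_eq], weak h.bot_mem, fun γ₁ h₁ => ?_,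
    fun {γ₁ γ₂} h₁ => ?_, fun {γ₁ γ₂} h₁ => ?_, fun hi => ?_, fun {i T} hi => ?_⟩
  · rcases Finset.mem_insert.1 h₁ with rfl | h₁
    · rw [new, old h.bot_mem]
      exact (h.val_bot _ hγ).trans hX
    · rw [old h₁, old h.bot_mem]
      exact h.val_bot _ h₁
  · rcases Finset.mem_insert.1 h₁ with h₁ | h₁
    · cases h₁
      exact ⟨weak hγ, Finset.mem_insert_self _ _⟩
    · exact (h.mem_of_ord h₁).imp weak weak
  · rcases Finset.mem_insert.1 h₁ with h₁ | h₁
    · cases h₁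
      rwa [new, old hγ]
    · rw [old (h.mem_of_ord h₁).1, old (h.mem_of_ord h₁).2]
      exact h.val_ord h₁
  · obtain ⟨h₁, α, hα, hs⟩ := h.lv0 hi
    exact ⟨weak h₁, α, by rwa [old h₁], hs⟩
  · obtain ⟨h₁, hT⟩ := h.lvM hi
    refine ⟨fun γ₁ hm => weak (h₁ γ₁ hm), ?_⟩
    refine (ClsEnv.AgreeOn.sem_iff (ClsEnv.agreeOn_extend hdom fun γ₁ hm => ?_) w (s i)).1 hT
    rw [h.dom_eq]
    exact h₁ γ₁ hm

theorem Ctx.Models.var0 (h : Γ.Models hwf w ρ s) {T : Ty0} {γ : Cls} (hγ : γ ∈ Γ.cls) {α : Param}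
    (hα : α ∈ ρ.val γ) : (Γ.var0 T γ).Models hwf w ρ (scons (.param α) s) := by
  refine { h with lv0 := fun {i T' γ'} hi => ?_, lvM := fun {i T'} hi => ?_ }
  · cases i with
    | zero =>
      obtain ⟨_, rfl⟩ : T = T' ∧ γ = γ' := by simpa [Ctx.var0] using hi
      exact ⟨hγ, α, hα, rfl⟩
    | succ i => exact h.lv0 hi
  · cases i with
    | zero => simp [Ctx.var0] at hi
    | succ i => exact h.lvM hi

theorem Ctx.Models.varM (h : Γ.Models hwf w ρ s) {T : TyM} (hT : Γ.Wf Sg T) {n : Nf}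
    (hn : T.sem (ρ.interp hwf) ρ.val w n) : (Γ.varM T).Models hwf w ρ (scons n s) := by
  refine { h with lv0 := fun {i T' γ'} hi => ?_, lvM := fun {i T'} hi => ?_ }
  · cases i with
    | zero => simp [Ctx.varM] at hi
    | succ i => exact h.lv0 hi
  · cases i with
    | zero =>
      obtain rfl : T = T' := by simpa [Ctx.varM] using hi
      exact ⟨hT, hn⟩
    | succ i => exact h.lvM hi

theorem Exec.bind_subst {I : OpInterp W} {Δ : Finset OpName} {Q Q' : W → Nf → Prop} {t t' : Tm}
    (H : Exec I Δ Q w (t.subst s) []) (hQ : ∀ w w' n, w' ≤ w → Q w n → Q w' n)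
    (H' : ∀ w' ≤ w, ∀ n, Q w' n → Exec I Δ Q' w' (t'.subst (scons n s)) []) :
    Exec I Δ Q' w ((Tm.bind t t').subst s) [] :=
  H.bind hQ fun w' hw n hn => by
    rw [Tm.subst_inst]
    exact H' w' hw n hn

theorem Exec.mkvar (I : OpInterp W) (Δ : Finset OpName) (a : Ann) (s : ℕ → Nf) :
    Exec I Δ (fun _ n => ∃ α, n = .param α) w (a.mkvar.subst s) [] :=
  .gen fun α _ _ => .ret ⟨α, rfl⟩

/-- `Γ ⊢ t` builds an AST of classifier `γ` with effects `Δ`. -/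
def BuildsCode (hwf : WellFounded (CallLt Sg W)) (Γ : Ctx) (γ : Cls) (t : Tm) (Δ : Finset OpName) :
    Prop :=
  ∀ w ρ s, Γ.Models hwf w ρ s →
    Exec (ρ.interp hwf) Δ (fun _ n => n.fvs ⊆ ρ.val γ) w (t.subst s) []

variable {γ γ' : Cls} {Δ : Finset OpName} {t t₁ t₂ : Tm}

theorem BuildsCode.sub (h : BuildsCode hwf Γ γ' t Δ) (hle : Γ.Le γ' γ) : BuildsCode hwf Γ γ t Δ :=
  fun w ρ s hs => (h w ρ s hs).imp (fun _ _ _ _ _ => id) (fun _ _ _ => id)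
    fun _ _ _ hn => hn.trans (hs.val_mono hle)

/-- An AST constructor with a single subtree and no binding. -/
theorem BuildsCode.node₁ (h : BuildsCode hwf Γ γ t Δ) (node : Nf → Nf)
    (hsub : ∀ n s, (node (.var 0)).subst (scons n s) = node n) (hfvs : ∀ n, (node n).fvs = n.fvs) :
    BuildsCode hwf Γ γ (.bind t (.ret (node (.var 0)))) Δ := fun w ρ s hs =>
  (h w ρ s hs).bind_subst (fun _ _ _ _ => id) fun w' _ n hn => by
    rw [Tm.subst, hsub]
    exact .ret ((hfvs n).trans_subset hn)

/-- An AST constructor with two subtrees and no binding. -/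
theorem BuildsCode.node₂ (h₁ : BuildsCode hwf Γ γ t₁ Δ) (h₂ : BuildsCode hwf Γ γ t₂ Δ)
    (node : Nf → Nf → Nf)
    (hsub : ∀ n n' s, (node (.var 1) (.var 0)).subst (scons n (scons n' s)) = node n' n)
    (hfvs : ∀ n n', (node n n').fvs = n.fvs ∪ n'.fvs) :
    BuildsCode hwf Γ γ
      (.bind t₁ (.bind (t₂.rename Nat.succ) (.ret (node (.var 1) (.var 0))))) Δ := fun w ρ s hs => by
  refine (h₁ w ρ s hs).bind_subst (fun _ _ _ _ => id) fun w' hw n hn => ?_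
  refine Exec.bind_subst (Q := fun _ n => n.fvs ⊆ ρ.val γ) ?_ (fun _ _ _ _ => id)
    fun w'' _ n' hn' => ?_
  · rw [Tm.rename_succ_subst]
    exact h₂ w' ρ s (hs.mono hw)
  · rw [Tm.subst, hsub]
    exact .ret ((hfvs n n').trans_subset (Set.union_subset hn hn'))

/-- The body of a level `0` binder, seen from outside of the scope of the binder: its free `Var`s are
among those of the enclosing scope and the new formal parameter. -/
theorem BuildsCode.body {S : Ty0} (h : BuildsCode hwf ((Γ.scope γ γ').var0 S γ') γ' t Δ)
    (hγ : γ ∈ Γ.cls) (hγ' : γ' ∉ Γ.cls) (hs : Γ.Models hwf w ρ s) (α : Param) :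
    Exec (ρ.interp hwf) Δ (fun _ n => n.fvs ⊆ insert α (ρ.val γ)) w
      (t.subst (scons (.param α) s)) [] := by
  have new : (ρ.extend γ' (insert α (ρ.val γ))).val γ' = insert α (ρ.val γ) :=
    Function.update_self ..
  have H := h w _ _ ((hs.scope hγ hγ' (Set.subset_insert α _)).var0 (T := S) (α := α)
    (Finset.mem_insert_self _ _) (by simp [new]))
  rw [new] at H
  exact H.leaveScope (by simpa [hs.dom_eq] using hγ')

/-- The analogue of `BuildsCode.body` for the two formal parameters of an operation clause, which
share a classifier. -/
theorem BuildsCode.body₂ {S S' : Ty0}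
    (h : BuildsCode hwf (((Γ.scope γ γ').var0 S γ').var0 S' γ') γ' t Δ)
    (hγ : γ ∈ Γ.cls) (hγ' : γ' ∉ Γ.cls) (hs : Γ.Models hwf w ρ s) (α β : Param) :
    Exec (ρ.interp hwf) Δ (fun _ n => n.fvs ⊆ insert α (insert β (ρ.val γ))) w
      (t.subst (scons (.param β) (scons (.param α) s))) [] := by
  have new : (ρ.extend γ' (insert α (insert β (ρ.val γ)))).val γ' = insert α (insert β (ρ.val γ)) :=
    Function.update_self ..
  have hsub : ρ.val γ ⊆ insert α (insert β (ρ.val γ)) :=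
    (Set.subset_insert β _).trans (Set.subset_insert α _)
  have H := h w _ _ (((hs.scope hγ hγ' hsub).var0 (T := S) (α := α) (Finset.mem_insert_self _ _)
    (by simp [new])).var0 (T := S') (α := β) (Finset.mem_insert_self _ _) (by simp [new]))
  rw [new] at H
  exact H.leaveScope (by simpa [hs.dom_eq] using hγ')

/-- An AST binder for a single formal parameter, as in `λ` and `return`. -/
theorem BuildsCode.binder {a : Ann} {S : Ty0}
    (h : BuildsCode hwf ((Γ.scope γ γ').var0 S γ') γ' t Δ) (hγ : γ ∈ Γ.cls) (hγ' : γ' ∉ Γ.cls)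
    (node : Nf → Nf → Nf)
    (hsub : ∀ n n' s, (node (.var 1) (.var 0)).subst (scons n (scons n' s)) = node n' n)
    (hfvs : ∀ n n', (node n n').fvs = n.fvs ∪ (n'.fvs \ n.params)) :
    BuildsCode hwf Γ γ (.bind a.mkvar (.bind t (.ret (node (.var 1) (.var 0))))) Δ :=
  fun w ρ s hs => by
  refine (Exec.mkvar _ _ a s).bind_subst (fun _ _ _ _ => id) fun w' hw _ hα => ?_
  obtain ⟨α, rfl⟩ := hα
  refine (h.body hγ hγ' (hs.mono hw) α).bind_subst (fun _ _ _ _ => id) fun w'' _ n hn => ?_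
  rw [Tm.subst, hsub]
  refine .ret ?_
  rw [hfvs, Nf.fvs, Set.empty_union]
  exact Set.sdiff_subset_iff.2 hn

theorem BuildsCode.doBinder {a : Ann} {S : Ty0} (h₁ : BuildsCode hwf Γ γ t₁ Δ)
    (h₂ : BuildsCode hwf ((Γ.scope γ γ').var0 S γ') γ' t₂ Δ) (hγ : γ ∈ Γ.cls) (hγ' : γ' ∉ Γ.cls) :
    BuildsCode hwf Γ γ (.bind t₁ (.bind a.mkvar (.bind (t₂.rename (upRen Nat.succ))
      (.ret (.astDo (.var 2) (.var 1) (.var 0)))))) Δ := fun w ρ s hs => by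
  refine (h₁ w ρ s hs).bind_subst (fun _ _ _ _ => id) fun w₁ hw₁ n₁ hn₁ => ?_
  refine (Exec.mkvar _ _ a _).bind_subst (fun _ _ _ _ => id) fun w₂ hw₂ _ hα => ?_
  obtain ⟨α, rfl⟩ := hα
  have hb := h₂.body hγ hγ' (hs.mono (hw₂.trans hw₁)) α
  refine Exec.bind_subst (Q := fun _ n => n.fvs ⊆ insert α (ρ.val γ)) ?_ (fun _ _ _ _ => id)
    fun w₃ _ n hn => ?_
  -- The renaming skips the AST of `e₁`, which is variable `1` here.
  · rw [rename_subst.2.1]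
    convert hb using 2
    funext i
    cases i <;> rfl
  · refine .ret (Set.union_subset (Set.union_subset hn₁ (Set.empty_subset _)) ?_)
    exact Set.sdiff_subset_iff.2 hn

theorem BuildsCode.opBinder {a b : Ann} {o : OpName} {S S' : Ty0} (h₁ : BuildsCode hwf Γ γ t₁ Δ)
    (h₂ : BuildsCode hwf (((Γ.scope γ γ').var0 S γ').var0 S' γ') γ' t₂ Δ) (hγ : γ ∈ Γ.cls)
    (hγ' : γ' ∉ Γ.cls) :
    BuildsCode hwf Γ γ (.bind t₁ (.bind a.mkvar (.bind b.mkvar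
      (.bind (t₂.rename (upRen (upRen Nat.succ)))
        (.ret (.astHop o (.var 3) (.var 2) (.var 1) (.var 0))))))) Δ := fun w ρ s hs => by
  refine (h₁ w ρ s hs).bind_subst (fun _ _ _ _ => id) fun w₁ hw₁ n₁ hn₁ => ?_
  refine (Exec.mkvar _ _ a _).bind_subst (fun _ _ _ _ => id) fun w₂ hw₂ _ hα => ?_
  obtain ⟨α, rfl⟩ := hα
  refine (Exec.mkvar _ _ b _).bind_subst (fun _ _ _ _ => id) fun w₃ hw₃ _ hβ => ?_
  obtain ⟨β, rfl⟩ := hβ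
  have hb := h₂.body₂ hγ hγ' (hs.mono (hw₃.trans (hw₂.trans hw₁))) α β
  refine Exec.bind_subst (Q := fun _ n => n.fvs ⊆ insert α (insert β (ρ.val γ))) ?_
    (fun _ _ _ _ => id) fun w₄ _ n hn => ?_
  · rw [rename_subst.2.1]
    convert hb using 2
    funext i
    rcases i with _ | _ | i <;> rfl
  · refine .ret (Set.union_subset (Set.union_subset (Set.union_subset hn₁ (Set.empty_subset _))
      (Set.empty_subset _)) (Set.sdiff_subset_iff.2 (hn.trans ?_)))
    rintro x (rfl | rfl | hx)
    · exact .inl (.inl rfl)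
    · exact .inl (.inr rfl)
    · exact .inr hx

/-- The semantic typing of level `-1` values. -/
def SemValM (hwf : WellFounded (CallLt Sg W)) (Γ : Ctx) (n : Nf) (T : TyM) : Prop :=
  ∀ w ρ s, Γ.Models hwf w ρ s → T.sem (ρ.interp hwf) ρ.val w (n.subst s)

/-- The semantic typing of level `-1` expressions. -/
def SemExpM (hwf : WellFounded (CallLt Sg W)) (Γ : Ctx) (t : Tm) (T : TyM) (Δ : Finset OpName) :
    Prop :=
  ∀ w ρ s, Γ.Models hwf w ρ s →
    Exec (ρ.interp hwf) Δ (T.sem (ρ.interp hwf) ρ.val) w (t.subst s) []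

/-- The semantic typing of level `-1` handlers: of the return clause, and of every operation clause.
The operations that are handled have well-scoped types, so that their calls come with arguments of
the expected type. -/
structure SemHdlM (hwf : WellFounded (CallLt Sg W)) (Γ : Ctx) (h : Hd) (S T : TyM)
    (Δ : Finset OpName) : Prop where
  ret : ∀ w ρ s, Γ.Models hwf w ρ s → ∀ n, S.sem (ρ.interp hwf) ρ.val w n →
    Exec (ρ.interp hwf) Δ (T.sem (ρ.interp hwf) ρ.val) w (h.retBody.subst (scons n s)) []
  op : ∀ w ρ s, Γ.Models hwf w ρ s → ∀ o t, (h.subst s).HasClause o t →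
    ∃ A B, Sg.comp o = some (A, B) ∧ OpScoped Sg ρ.dom o ∧
      (∀ w' n, B.sem (ρ.interp hwf) ρ.val w' n → ρ.opRes Sg o n) ∧
      ∀ n k, A.sem (ρ.interp hwf) ρ.val w n →
        (TyM.cont B Δ T).sem (ρ.interp hwf) ρ.val w k →
        Exec (ρ.interp hwf) Δ (T.sem (ρ.interp hwf) ρ.val) w (t.inst₂ n k) []

theorem SemExpM.handle {h : Hd} {S T : TyM} {Δ₁ Δ₂ : Finset OpName} (ht : SemExpM hwf Γ t S Δ₁)
    (hh : SemHdlM hwf Γ h S T Δ₂) (hdom : ∀ o ∈ Δ₁ \ Δ₂, o ∈ h.dom) :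
    SemExpM hwf Γ (.handle t h) T Δ₂ := fun w ρ s hs => by
  refine .pushHandle <| (ht w ρ s hs).handleFrame ?_ ρ.interp_arg_mono (TyM.sem_mono _ _ _)
    (TyM.sem_mono _ _ _) (fun w' hw n hn => ?_) fun w' hw o ho t n E v hc ha hv hE => ?_
  · rwa [Hd.dom_subst]
  · rw [Hd.retBody_subst, Tm.subst_inst]
    exact hh.ret w' ρ s (hs.mono hw) n hn
  · obtain ⟨A, B, hAB, hsc, hB, H⟩ :=
      hh.op v ρ s (hs.mono ((le_of_later hv).trans hw)) o t hc
    exact H n _ (ClsEnv.interp_arg_iff.1 ha hsc A B hAB v hv)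
      ⟨E, rfl, fun v' hv' n' hn' => hE v' hv' n' (hB v' n' hn')⟩

theorem SemHdlM.cons {h : Hd} {S T A : TyM} {B : Ty0} {ξ : Finset OpName} {o : OpName}
    (hh : SemHdlM hwf Γ h S T Δ) (hcomp : Sg.comp o = some (A, .code B ξ γ)) (hA : Γ.Wf Sg A)
    (hk : Γ.Wf Sg (.cont (.code B ξ γ) Δ T))
    (ht : SemExpM hwf ((Γ.varM A).varM (.cont (.code B ξ γ) Δ T)) t T Δ) :
    SemHdlM hwf Γ (.op h o t) S T Δ := by
  refine ⟨hh.ret, fun w ρ s hs o' t' hc => ?_⟩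
  cases hc with
  | there hc => exact hh.op w ρ s hs o' t' hc
  | here =>
    have hsc : OpScoped Sg ρ.dom o := by
      intro A' B' hAB γ' hγ'
      obtain ⟨rfl, rfl⟩ : A = A' ∧ TyM.code B ξ γ = B' := by simpa [hcomp] using hAB
      rw [hs.dom_eq]
      refine hγ'.elim (hA γ') fun hm => hk γ' (.here ?_)
      cases hm with
      | here hm => exact Finset.mem_union_left _ hm
      | arg ho => simp [TyM.ops] at ho
      | res ho => simp [TyM.ops] at ho
    refine ⟨A, _, hcomp, hsc, fun w' n hn => ⟨hsc, fun A' T' ξ' γ' hAB => ?_⟩, fun n k hn hk' => ?_⟩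
    · obtain ⟨_, _, _, rfl⟩ : A = A' ∧ B = T' ∧ ξ = ξ' ∧ γ = γ' := by simpa [hcomp] using hAB
      exact hn
    · rw [Tm.subst_inst₂]
      -- `hk` is about `Γ`, which has the same classifiers as `Γ.varM A` by definition.
      exact ht w ρ _ ((hs.varM hA hn).varM hk hk')

theorem HdlM.dom_elaborate (h : HdlM) : h.elaborate.dom = h.dom := by
  cases h with
  | ret e => rfl
  | op h o e => simp only [HdlM.elaborate, Hd.dom, HdlM.dom, HdlM.dom_elaborate h]

variable (hwf)

mutual

/-- The fundamental theorem of the logical relation, for level `0` values. It is proved together with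
its analogues for the other judgements. -/
theorem TyVal0.sound {M : Mode} {Γ : Ctx} {γ : Cls} {v : Val0} {T : Ty0} {Δ : Finset OpName} :
    TyVal0 Sg M Γ γ v T Δ → BuildsCode hwf Γ γ v.elaborate Δ
  | .nat m => fun _ _ _ _ => .ret (Set.empty_subset _)
  | .var hi => fun _ _ s hs => by
    obtain ⟨_, α, hα, h⟩ := hs.lv0 hi
    refine .ret ?_
    simpa [Nf.subst, h, Nf.fvs, Nf.params] using hα
  | .lam hγ hγ' he => (TyExp0.sound he).binder hγ hγ' .astLam (fun _ _ _ => rfl) fun _ _ => rfl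
  | .sub hle hv => (TyVal0.sound hv).sub hle

theorem TyExp0.sound {M : Mode} {Γ : Ctx} {γ : Cls} {e : Exp0} {T : Ty0} {Δ ξ : Finset OpName} :
    TyExp0 Sg M Γ γ e T Δ ξ → BuildsCode hwf Γ γ e.elaborate Δ
  | .app h₁ h₂ =>
    (TyVal0.sound h₁).node₂ (TyVal0.sound h₂) .astApp (fun _ _ _ => rfl) fun _ _ => rfl
  | .continue h₁ h₂ =>
    (TyVal0.sound h₁).node₂ (TyVal0.sound h₂) .astContinue (fun _ _ _ => rfl) fun _ _ => rfl
  | .ret h => (TyVal0.sound h).node₁ .astRet (fun _ _ => rfl) fun _ => rfl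
  | .bind hγ hγ' h₁ h₂ => (TyExp0.sound h₁).doBinder (TyExp0.sound h₂) hγ hγ'
  | .op (o := o) h _ _ => (TyVal0.sound h).node₁ (.astOp o) (fun _ _ => rfl) fun _ => rfl
  | .handle h₁ h₂ _ =>
    (TyExp0.sound h₁).node₂ (TyHdl0.sound h₂) .astHandle (fun _ _ _ => rfl) fun _ _ => rfl
  | .splice h => TyExpM.sound h
  | .sub hle h => (TyExp0.sound h).sub hle

theorem TyHdl0.sound {M : Mode} {Γ : Ctx} {γ : Cls} {h : Hdl0} {S T : Ty0}
    {Δ ξ₁ ξ₂ : Finset OpName} :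
    TyHdl0 Sg M Γ γ h S ξ₁ T ξ₂ Δ → BuildsCode hwf Γ γ h.elaborate Δ
  | .ret hγ hγ' he => (TyExp0.sound he).binder hγ hγ' .astHret (fun _ _ _ => rfl) fun _ _ => rfl
  | .op hγ hγ' _ hh he _ _ => (TyHdl0.sound hh).opBinder (TyExp0.sound he) hγ hγ'
  | .sub hle h => (TyHdl0.sound h).sub hle

theorem TyValM.sound {Γ : Ctx} {v : ValM} {T : TyM} :
    TyValM Sg Γ v T → SemValM hwf Γ v.elaborate T
  | .nat _ => fun _ _ _ _ => trivial
  | .var hi => fun _ _ _ hs => (hs.lvM hi).2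
  | .lam hS he => fun _ _ _ hs => ⟨_, rfl, fun w' hw n hn => by
    rw [Tm.subst_inst]
    exact TyExpM.sound he w' _ _ ((hs.mono hw).varM hS hn)⟩

theorem TyExpM.sound {Γ : Ctx} {e : ExpM} {T : TyM} {Δ : Finset OpName} :
    TyExpM Sg Γ e T Δ → SemExpM hwf Γ e.elaborate T Δ
  | .app h₁ h₂ => fun w ρ s hs => by
    obtain ⟨t, ht, H⟩ := TyValM.sound h₁ w ρ s hs
    rw [ExpM.elaborate, Tm.subst, ht]
    exact .app fun w' hw => H w' (le_of_later hw) _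
      (TyM.sem_mono _ _ _ _ _ _ (le_of_later hw) (TyValM.sound h₂ w ρ s hs))
  | .continue h₁ h₂ => fun w ρ s hs => by
    obtain ⟨E, hE, H⟩ := TyValM.sound h₁ w ρ s hs
    rw [ExpM.elaborate, Tm.subst, hE]
    refine .cnt fun w' hw => ?_
    rw [List.append_nil]
    exact H w' (le_of_later hw) _ (TyValM.sound h₂ w ρ s hs)
  | .ret h => fun w ρ s hs => .ret (TyValM.sound h w ρ s hs)
  | .bind hS h₁ h₂ => fun w ρ s hs =>
    (TyExpM.sound h₁ w ρ s hs).bind_subst (TyM.sem_mono _ _ _) fun w' hw _ hn =>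
      TyExpM.sound h₂ w' ρ _ ((hs.mono hw).varM hS hn)
  | .op h ho hcomp => fun w ρ s hs => by
    refine .call ho (by simp [EvCtx.handled]) ?_ fun n hn => .ret (hn.2 _ _ _ _ hcomp)
    refine ClsEnv.interp_arg_iff.2 fun _ A B hAB w' hw => ?_
    obtain ⟨rfl, rfl⟩ : _ = A ∧ _ = B := by simpa [hcomp] using hAB
    exact TyM.sem_mono _ _ _ _ _ _ (le_of_later hw) (TyValM.sound h w ρ s hs)
  | .handle h₁ h₂ hdom =>
    (TyExpM.sound h₁).handle (TyHdlM.sound h₂) fun o ho => by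
      rw [HdlM.dom_elaborate]
      exact hdom o ho
  | .quote h => TyExp0.sound h
  -- At a `Code` type, `SemExpM` unfolds to `BuildsCode`.
  | .sub hle h => BuildsCode.sub (TyExpM.sound h) hle

theorem TyHdlM.sound {Γ : Ctx} {h : HdlM} {S T : TyM} {Δ₁ Δ₂ : Finset OpName} :
    TyHdlM Sg Γ h S Δ₁ T Δ₂ → SemHdlM hwf Γ h.elaborate S T Δ₂
  | .ret hS he =>
    ⟨fun w ρ _ hs _ hn => TyExpM.sound he w ρ _ (hs.varM hS hn), fun _ _ _ _ _ _ hc => nomatch hc⟩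
  | .op hcomp hh hA hk he _ _ => (TyHdlM.sound hh).cons hcomp hA hk (TyExpM.sound he)

end

/-- Executions of a closed, well-typed program. -/
theorem TyExp0.exec (hwf : WellFounded (CallLt Sg W)) {e : Exp0} {T : Ty0} {M : Mode}
    {Δ ξ : Finset OpName}
    (he : TyExp0 Sg M .bot clsBot e T Δ ξ) (w : W) :
    ∃ I : OpInterp W, (∀ o w w' n, w' ≤ w → I.arg o w n → I.arg o w' n) ∧
      Exec I Δ (fun _ n => n.fvs = ∅) w e.elaborate [] := by
  let ρ : ClsEnv := ⟨{clsBot}, fun _ => ∅⟩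
  have H := TyExp0.sound hwf he w ρ .var ⟨by simp [ρ, Ctx.bot], by simp [Ctx.bot],
    fun _ _ => subset_rfl, by simp [Ctx.bot], by simp [Ctx.bot], by simp [Ctx.bot],
    by simp [Ctx.bot]⟩
  rw [subst_var.2.1] at H
  exact ⟨_, ρ.interp_arg_mono, H.imp (fun _ _ _ _ _ => id) (fun _ _ _ => id)
    fun _ _ _ => Set.subset_empty_iff.1⟩

end Sound

/-! ### Executions and reduction -/

section Adequacy

variable {W : Type} [Clock W] {I : OpInterp W} {Q : W → Nf → Prop} {w w' : W}
  {next : Finset ℕ → ℕ}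

/-- Preservation: all steps follow the execution, not just those that it goes through. Popping a frame
undoes a push, which the execution makes without passing to a later index. -/
theorem Exec.step {Δ : Finset OpName} {c c' : Config}
    (hI : ∀ o w w' n, w' ≤ w → I.arg o w n → I.arg o w' n)
    (hQ : ∀ w w' n, w' ≤ w → Q w n → Q w' n) (H : Exec I Δ Q w c.tm c.ctx)
    (hs : Step next c c') (hw : later w w') : Exec I Δ Q w' c'.tm c'.ctx := by
  cases hs with
  | app t n E U =>
    cases H with
    | app h => exact h w' hw
  | seq n t E U =>
    cases H with
    | pushBind h =>
      cases h with
      | seq h => exact h w' hw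
  | hdl n h E U =>
    cases H with
    | pushHandle h =>
      cases h with
      | hdl h => exact h w' hw
  | psh F t E U =>
    refine Exec.mono hI hQ (le_of_later hw) ?_
    cases F with
    | bind t' =>
      cases H with
      | pushBind h => exact h
    | handle h' =>
      cases H with
      | pushHandle h => exact h
  | pop n F E U =>
    refine Exec.mono hI hQ (le_of_later hw) ?_
    cases F with
    | bind t' => exact .pushBind H
    | handle h' => exact .pushHandle H
  | gen R γ E U =>
    cases H with
    | gen h => exact h _ w' hw
  | op o n E₁ E₂ h t U hc ho =>
    cases H with
    | op hE hdom hn h =>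
      obtain ⟨rfl, rfl, rfl⟩ := EvCtx.split_unique hE hc.mem_dom hdom ho hn
      exact h t w' hc hw
    | call _ hn _ _ => simp [EvCtx.handled_append, EvCtx.handled, hc.mem_dom] at hn
  | cnt E₁ E₂ n U =>
    generalize hk : EvCtx.reify E₂ = k at H
    cases H with
    | cnt h =>
      obtain rfl := EvCtx.reify_injective hk
      exact h w' hw

theorem Exec.progress (next : Finset ℕ → ℕ) {t : Tm} {E : EvCtx} (H : Exec I ∅ Q w t E)
    (U : Finset ℕ) :
    (∃ n, t = .ret n ∧ E = [] ∧ Q w n) ∨ ∃ c', Step next ⟨t, E, U⟩ c' := by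
  cases H with
  | ret h => exact .inl ⟨_, rfl, rfl, h⟩
  | pushBind _ => exact .inr ⟨_, .psh (.bind _) _ _ _⟩
  | pushHandle _ => exact .inr ⟨_, .psh (.handle _) _ _ _⟩
  | app _ => exact .inr ⟨_, .app _ _ _ _⟩
  | seq _ => exact .inr ⟨_, .pop _ _ _ _⟩
  | hdl _ => exact .inr ⟨_, .pop _ _ _ _⟩
  | gen _ => exact .inr ⟨_, .gen _ _ _ _⟩
  | cnt _ => exact .inr ⟨_, .cnt _ _ _ _⟩
  | op hE hdom hn _ =>
    subst hE
    obtain ⟨t, ht⟩ := Hd.exists_hasClause hdom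
    exact .inr ⟨_, .op _ _ _ _ _ _ _ ht hn⟩
  | call ho => simp at ho

/-- If every index has a later one, a program with an empty effect set can be run to its end, along
its execution. -/
theorem Exec.terminates (next : Finset ℕ → ℕ) (hlater : ∀ w : W, ∃ w', later w w') {t : Tm}
    {E : EvCtx} (H : Exec I ∅ Q w t E) (U : Finset ℕ) :
    ∃ n U' w', Steps next ⟨t, E, U⟩ ⟨.ret n, [], U'⟩ ∧ Q w' n := by
  have steps {c c' : Config} (hs : Steps next c c')
      (h : ∃ n U' w', Steps next c' ⟨.ret n, [], U'⟩ ∧ Q w' n) :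
      ∃ n U' w', Steps next c ⟨.ret n, [], U'⟩ ∧ Q w' n := by
    obtain ⟨n, U', w', h, hn⟩ := h
    exact ⟨n, U', w', hs.trans h, hn⟩
  induction H generalizing U with
  | ret h => exact ⟨_, U, _, .refl, h⟩
  | pushBind _ ih => exact steps (.single (.psh (.bind _) _ _ _)) (ih U)
  | pushHandle _ ih => exact steps (.single (.psh (.handle _) _ _ _)) (ih U)
  | @app w _ _ _ _ ih =>
    obtain ⟨v, hv⟩ := hlater w
    exact steps (.single (.app _ _ _ _)) (ih v hv U)
  | @seq w _ _ _ _ ih =>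
    obtain ⟨v, hv⟩ := hlater w
    exact steps ((Relation.ReflTransGen.single (.pop _ _ _ _)).tail (.seq _ _ _ _)) (ih v hv U)
  | @hdl w _ _ _ _ ih =>
    obtain ⟨v, hv⟩ := hlater w
    exact steps ((Relation.ReflTransGen.single (.pop _ _ _ _)).tail (.hdl _ _ _ _)) (ih v hv U)
  | @gen w _ _ _ _ ih =>
    obtain ⟨v, hv⟩ := hlater w
    exact steps (.single (.gen _ _ _ _)) (ih _ v hv _)
  | @cnt w _ _ _ _ ih =>
    obtain ⟨v, hv⟩ := hlater w
    exact steps (.single (.cnt _ _ _ _)) (ih v hv U)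
  | @op w _ _ _ _ _ _ hE hdom hn _ ih =>
    subst hE
    obtain ⟨v, hv⟩ := hlater w
    obtain ⟨t, ht⟩ := Hd.exists_hasClause hdom
    exact steps (.single (.op _ _ _ _ _ _ _ ht hn)) (ih t v ht hv U)
  | call ho => simp at ho

end Adequacy

/-- Step counting: the execution is observed for as many steps as the index says. -/
instance : Clock ℕ where
  later w w' := w' < w
  le_of_later h := h.le
  later_of_le h h' := h'.trans_le h
  later_of_later_of_le h h' := h'.trans_lt h

/-- No step counting: the execution is observed to its end. -/
instance : Clock Unit where
  later _ _ := True
  le_of_later _ := le_rfl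
  later_of_le _ _ := trivial
  later_of_later_of_le _ _ := trivial

theorem callLt_nat_wf (Sg : Sig) : WellFounded (CallLt Sg ℕ) :=
  Subrelation.wf (fun h => h.1) (InvImage.wf (fun p : ℕ × OpName => p.1) Nat.lt_wfRel.wf)

theorem callLt_unit_wf {Sg : Sig} (h : Sg.NonRecursive) : WellFounded (CallLt Sg Unit) :=
  Subrelation.wf (fun h => h.2) (InvImage.wf (fun p : Unit × OpName => p.2) h)

end RefinedClassifiers

open RefinedClassifiers
/-- Correctness of refined environment classifiers. -/
theorem mainTheorem3 (Sg : Sig) (next : Finset ℕ → ℕ) (hnext : ∀ U, next U ∉ U)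
    (e : Exp0) (T : Ty0) (t : Tm)
    (he : TyExp0 Sg .c Ctx.bot clsBot e T ∅ ∅) (ht : e.elaborate = t) :
    (∀ c : Config, Steps next ⟨t, [], ∅⟩ c →
      (∃ (n : Nf) (U : Finset ℕ), c = ⟨.ret n, [], U⟩ ∧ n.fvs = ∅) ∨
        ∃ c' : Config, Step next c c') ∧
    (Sg.NonRecursive →
      ∃ (n : Nf) (U : Finset ℕ), Steps next ⟨t, [], ∅⟩ ⟨.ret n, [], U⟩ ∧ n.fvs = ∅) := by
  subst ht
  refine ⟨fun c hc => ?_, fun hrec => ?_⟩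
  · have inv : ∀ w : ℕ, ∃ I : OpInterp ℕ, (∀ o w w' n, w' ≤ w → I.arg o w n → I.arg o w' n) ∧
        Exec I ∅ (fun _ n => n.fvs = ∅) w c.tm c.ctx := by
      induction hc with
      | refl => exact TyExp0.exec (callLt_nat_wf Sg) he
      | tail _ hs ih =>
        intro w
        obtain ⟨I, hI, H⟩ := ih (w + 1)
        exact ⟨I, hI, H.step hI (fun _ _ _ _ => id) hs (Nat.lt_succ_self w)⟩
    obtain ⟨I, -, H⟩ := inv 0
    rcases H.progress next c.used with ⟨n, htm, hctx, hn⟩ | h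
    · exact .inl ⟨n, c.used, by rw [← htm, ← hctx], hn⟩
    · exact .inr h
  · obtain ⟨I, -, H⟩ := TyExp0.exec (callLt_unit_wf hrec) he ()
    obtain ⟨n, U, -, hs, hn⟩ := H.terminates next (fun _ => ⟨(), trivial⟩) ∅
    exact ⟨n, U, hs, hn⟩
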